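/- Let $n\ge 2$ be an integer, $\alpha\in\mathbb R$, and let $U\subset\mathbb R^2$ be a nonempty connected open set of points $(x,y)$ on which $y\neq0$. A smooth vector field $X=\xi(x,y)\,\partial_x+\eta(x,y)\,\partial_y$ on $U$ is called a Lie point symmetry of $$\Omega:=yy^{(n+1)}+\alpha y'y^{(n)}=0$$ if $X^{(n+1)}\Omega=0$ at every jet $(x,y,y',\dots,y^{(n+1)})$ with $(x,y)\in U$ and $\Omega=0$. Here $X^{(n+1)}=\xi\partial_x+\eta\partial_y+\sum_{k=1}^{n+1}\eta^{(k)}\partial_{y^{(k)}}$ is the prolongation of $X$, with $\eta^{(k)}=D^k\eta-\sum_{j=1}^k\binom kj y^{(k+1-j)}D^j\xi$, and $D=\partial_x+y'\partial_y+y''\partial_{y'}+\cdots$ is the total derivative. In each of the following cases the Lie point symmetries on $U$ form a real Lie algebra under the commutator of vector fields, with the stated basis. - If $\alpha=0$, the algebra has dimension $n+5$, with basis $\partial_y,\ x\partial_y,\dots,x^n\partial_y,\ y\partial_y,\ \partial_x,\ x\partial_x+\tfrac n2y\partial_y,\ x^2\partial_x+nxy\partial_y$. It is a semidirect sum $(n+1)A_1\oplus_s\{A_1\oplus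 sl(2,\mathbb R)\}$, in which the fields $x^k\partial_y$ ($0\le k\le n$) span the abelian ideal $(n+1)A_1$, $y\partial_y$ spans $A_1$, and the last three fields span $sl(2,\mathbb R)$. - If $n\ge3$ and $\alpha=\frac{n+1}{n-1}$, the algebra has dimension $4$, with basis $\partial_x,\ x\partial_x+\tfrac{n-1}2y\partial_y,\ x^2\partial_x+(n-1)xy\partial_y,\ y\partial_y$, and is isomorphic to $A_1\oplus sl(2,\mathbb R)$. - If $\alpha\ne0$ and $\alpha\neq\frac{n+1}{n-1}$, the algebra has dimension $3$, with basis $\partial_x,\ x\partial_x,\ y\partial_y$, and is isomorphic to $A_2\oplus A_1$. Here $mA_1$ is the abelian real Lie algebra of dimension $m$ and $A_2$ is the non-abelian real Lie algebra of dimension $2$. -/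

import Mathlib

open scoped ContDiff
open TopologicalSpace

noncomputable section

namespace LiePointSymmetry

/-! ### Smooth vector fields on an open subset of the `(x, y)`-plane -/

/-- The smooth vector fields `ξ(x,y) ∂_x + η(x,y) ∂_y` on an open set `U` of the plane. The field is
the map `(x, y) ↦ (ξ, η)`; since only its values on `U` matter, it is normalised to vanish off `U`,
so that two fields are equal exactly when they agree on `U`. -/
def smoothFields (U : Opens (ℝ × ℝ)) : Submodule ℝ (ℝ × ℝ → ℝ × ℝ) where
  carrier := {V | ContDiffOn ℝ ∞ V U ∧ ∀ p, p ∉ U → V p = 0}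
  add_mem' := fun hV hW => ⟨hV.1.add hW.1, fun p hp => by simp [hV.2 p hp, hW.2 p hp]⟩
  zero_mem' := ⟨contDiffOn_const, fun _ _ => rfl⟩
  smul_mem' := fun c _ hV => ⟨hV.1.const_smul c, fun p hp => by simp [hV.2 p hp]⟩

/-- The type of smooth vector fields on `U`. -/
def VField (U : Opens (ℝ × ℝ)) : Type := smoothFields U

namespace VField

variable {U : Opens (ℝ × ℝ)}

instance : AddCommGroup (VField U) := inferInstanceAs (AddCommGroup (smoothFields U))

instance : Module ℝ (VField U) := inferInstanceAs (Module ℝ (smoothFields U))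

/-- The underlying map `(x, y) ↦ (ξ(x, y), η(x, y))`. -/
def toFun (X : VField U) : ℝ × ℝ → ℝ × ℝ := X.1

/-- The coefficient `ξ` of `∂_x`. -/
def xi (X : VField U) (p : ℝ × ℝ) : ℝ := (X.toFun p).1

/-- The coefficient `η` of `∂_y`. -/
def eta (X : VField U) (p : ℝ × ℝ) : ℝ := (X.toFun p).2

theorem ext {X Y : VField U} (h : ∀ p ∈ U, X.toFun p = Y.toFun p) : X = Y := by
  refine Subtype.ext (funext fun p => ?_)
  by_cases hp : p ∈ U
  · exact h p hp
  · exact (X.2.2 p hp).trans (Y.2.2 p hp).symm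

@[simp] theorem toFun_add (X Y : VField U) : (X + Y).toFun = X.toFun + Y.toFun := rfl

@[simp] theorem toFun_zero : (0 : VField U).toFun = 0 := rfl

@[simp] theorem toFun_smul (c : ℝ) (X : VField U) : (c • X).toFun = c • X.toFun := rfl

theorem contDiffAt (X : VField U) {p : ℝ × ℝ} (hp : p ∈ U) : ContDiffAt ℝ ∞ X.toFun p :=
  X.2.1.contDiffAt (U.isOpen.mem_nhds hp)

theorem differentiableAt (X : VField U) {p : ℝ × ℝ} (hp : p ∈ U) :
    DifferentiableAt ℝ X.toFun p :=
  (X.contDiffAt hp).differentiableAt (by simp)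

/-- The restriction to `U` of a smooth vector field on the plane. -/
def restrict (U : Opens (ℝ × ℝ)) (V : ℝ × ℝ → ℝ × ℝ) (hV : ContDiffOn ℝ ∞ V U) : VField U :=
  ⟨Set.indicator U V, hV.congr fun _ hp => Set.indicator_of_mem hp V,
    fun _ hp => Set.indicator_of_notMem hp V⟩

theorem restrict_apply {V : ℝ × ℝ → ℝ × ℝ} {hV : ContDiffOn ℝ ∞ V U} {p : ℝ × ℝ} (hp : p ∈ U) :
    (restrict U V hV).toFun p = V p := Set.indicator_of_mem hp V

/-- The Lie bracket (commutator) of vector fields, computed on `U`. -/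
instance : Bracket (VField U) (VField U) where
  bracket X Y := restrict U (VectorField.lieBracket ℝ X.toFun Y.toFun) fun _ hp =>
    ((X.contDiffAt hp).lieBracket_vectorField (Y.contDiffAt hp) (m := ∞) (n := ∞)
      (by simp)).contDiffWithinAt

theorem lie_apply (X Y : VField U) {p : ℝ × ℝ} (hp : p ∈ U) :
    ⁅X, Y⁆.toFun p = VectorField.lieBracket ℝ X.toFun Y.toFun p := restrict_apply hp

theorem lie_eventuallyEq (X Y : VField U) {p : ℝ × ℝ} (hp : p ∈ U) :
    ⁅X, Y⁆.toFun =ᶠ[nhds p] VectorField.lieBracket ℝ X.toFun Y.toFun :=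
  Filter.eventuallyEq_of_mem (U.isOpen.mem_nhds hp) fun _ hq => lie_apply X Y hq

instance : LieRing (VField U) where
  add_lie X Y Z := ext fun p hp => by
    simp only [lie_apply _ _ hp, toFun_add, Pi.add_apply]
    exact VectorField.lieBracket_add_left (X.differentiableAt hp) (Y.differentiableAt hp)
  lie_add X Y Z := ext fun p hp => by
    simp only [lie_apply _ _ hp, toFun_add, Pi.add_apply]
    exact VectorField.lieBracket_add_right (Y.differentiableAt hp) (Z.differentiableAt hp)
  lie_self X := ext fun p hp => by simp [lie_apply _ _ hp]
  leibniz_lie X Y Z := ext fun p hp => by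
    simp only [lie_apply _ _ hp, toFun_add, Pi.add_apply]
    rw [(Filter.EventuallyEq.refl (nhds p) X.toFun).lieBracket_vectorField_eq
        (lie_eventuallyEq Y Z hp),
      (lie_eventuallyEq X Y hp).lieBracket_vectorField_eq (Filter.EventuallyEq.refl _ _),
      (Filter.EventuallyEq.refl (nhds p) Y.toFun).lieBracket_vectorField_eq
        (lie_eventuallyEq X Z hp)]
    exact VectorField.leibniz_identity_lieBracket (n := ∞)
      (by simpa using WithTop.coe_le_coe.2 (le_top : (2 : ℕ∞) ≤ ⊤))
      (X.contDiffAt hp) (Y.contDiffAt hp) (Z.contDiffAt hp)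

instance : LieAlgebra ℝ (VField U) where
  lie_smul c X Y := ext fun p hp => by
    simp only [lie_apply _ _ hp, toFun_smul, Pi.smul_apply]
    exact VectorField.lieBracket_const_smul_right (Y.differentiableAt hp)

end VField

/-- The vector field `x ^ i y ^ j ∂_x` on `U`. -/
def dx (U : Opens (ℝ × ℝ)) (i j : ℕ) : VField U :=
  VField.restrict U (fun p => (p.1 ^ i * p.2 ^ j, 0))
    (ContDiff.contDiffOn (by fun_prop))

/-- The vector field `x ^ i y ^ j ∂_y` on `U`. -/
def dy (U : Opens (ℝ × ℝ)) (i j : ℕ) : VField U :=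
  VField.restrict U (fun p => (0, p.1 ^ i * p.2 ^ j))
    (ContDiff.contDiffOn (by fun_prop))

/-! ### Jets, prolongation and the linearised symmetry condition -/

/-- Jets of functions `y(x)`: the pair `(x, u)` stands for the values of `x` and of
`y = u 0, y' = u 1, y'' = u 2, …`, which are independent coordinates. -/
abbrev Jet : Type := ℝ × (ℕ → ℝ)

/-- The total derivative `D = ∂_x + y' ∂_y + y'' ∂_{y'} + ⋯`: the derivative of a function of the
jet coordinates in the direction `(1, y', y'', …)`. -/
def totalDeriv (F : Jet → ℝ) (J : Jet) : ℝ :=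
  lineDeriv ℝ F J (1, fun k => J.2 (k + 1))

/-- A function of `(x, y)` as a function on jets. -/
def liftJet (f : ℝ × ℝ → ℝ) (J : Jet) : ℝ := f (J.1, J.2 0)

/-- The coefficient of `∂_{y^(k)}` in the prolongation of `ξ ∂_x + η ∂_y`, namely
`η^(k) = D^k η - ∑_{i=1}^{k} (k choose i) y^(k+1-i) D^i ξ`. -/
def etaCoeff {U : Opens (ℝ × ℝ)} (X : VField U) (k : ℕ) (J : Jet) : ℝ :=
  totalDeriv^[k] (liftJet X.eta) J -
    ∑ i ∈ Finset.Icc 1 k, (k.choose i : ℝ) * J.2 (k + 1 - i) * totalDeriv^[i] (liftJet X.xi) J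

/-- The prolongation `ξ ∂_x + η ∂_y + η^(1) ∂_{y'} + η^(2) ∂_{y''} + ⋯` of a vector field, at a
jet. Applied to a function of the derivatives up to order `m`, only the terms up to `η^(m)`
contribute, so that this is the action of the `m`-th prolongation. -/
def prolong {U : Opens (ℝ × ℝ)} (X : VField U) (J : Jet) : Jet :=
  (X.xi (J.1, J.2 0), fun k => etaCoeff X k J)

/-- `X` is (the generator of) a Lie point symmetry, on `U`, of the equation `F(x, y, y', …) = 0`:
the prolongation of `X` annihilates `F` at every jet over `U` with `F = 0`. -/
def IsLiePointSymmetry {U : Opens (ℝ × ℝ)} (F : Jet → ℝ) (X : VField U) : Prop :=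
  ∀ J : Jet, (J.1, J.2 0) ∈ U → F J = 0 → lineDeriv ℝ F J (prolong X J) = 0

/-- The left-hand side `y y^(n+1) + α y' y^(n)` of the equation. -/
def ode (n : ℕ) (α : ℝ) (J : Jet) : ℝ :=
  J.2 0 * J.2 (n + 1) + α * J.2 1 * J.2 n

/-! ### The three lists of vector fields -/

/-- `∂_y, x ∂_y, …, x ^ n ∂_y`, then `y ∂_y`, then
`∂_x, x ∂_x + (n/2) y ∂_y, x ^ 2 ∂_x + n x y ∂_y`. -/
def symZero (U : Opens (ℝ × ℝ)) (n : ℕ) : Fin (n + 1) ⊕ Fin 1 ⊕ Fin 3 → VField U :=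
  Sum.elim (fun k => dy U k 0)
    (Sum.elim ![dy U 0 1]
      ![dx U 0 0, dx U 1 0 + ((n : ℝ) / 2) • dy U 0 1, dx U 2 0 + (n : ℝ) • dy U 1 1])

/-- `∂_x, x ∂_x + ((n-1)/2) y ∂_y, x ^ 2 ∂_x + (n-1) x y ∂_y, y ∂_y`. -/
def symSpecial (U : Opens (ℝ × ℝ)) (n : ℕ) : Fin 4 → VField U :=
  ![dx U 0 0, dx U 1 0 + (((n : ℝ) - 1) / 2) • dy U 0 1,
    dx U 2 0 + ((n : ℝ) - 1) • dy U 1 1, dy U 0 1]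

/-- `∂_x, x ∂_x, y ∂_y`. -/
def symGeneric (U : Opens (ℝ × ℝ)) : Fin 3 → VField U :=
  ![dx U 0 0, dx U 1 0, dy U 0 1]

/-! ### The abstract Lie algebras -/

/-- `m A₁`: the abelian real Lie algebra of dimension `m`. -/
def AbelianLie (m : ℕ) : Type := Fin m → ℝ

namespace AbelianLie

variable {m : ℕ}

instance : AddCommGroup (AbelianLie m) := inferInstanceAs (AddCommGroup (Fin m → ℝ))

instance : Module ℝ (AbelianLie m) := inferInstanceAs (Module ℝ (Fin m → ℝ))

instance : LieRing (AbelianLie m) where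
  bracket _ _ := 0
  add_lie _ _ _ := (add_zero 0).symm
  lie_add _ _ _ := (add_zero 0).symm
  lie_self _ := rfl
  leibniz_lie _ _ _ := (add_zero 0).symm

instance : LieAlgebra ℝ (AbelianLie m) where
  lie_smul c _ _ := (smul_zero c).symm

/-- The standard basis vectors. -/
def unit (k : Fin m) : AbelianLie m := Pi.single (M := fun _ => ℝ) k 1

end AbelianLie

/-- `A₁`, the one-dimensional real Lie algebra. -/
abbrev A1 : Type := AbelianLie 1

/-- `A₂`, the two-dimensional non-abelian real Lie algebra, with basis `e₁ = (1, 0)`,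
`e₂ = (0, 1)` and `⁅e₁, e₂⁆ = e₁`. -/
def A2 : Type := ℝ × ℝ

namespace A2

instance : AddCommGroup A2 := inferInstanceAs (AddCommGroup (ℝ × ℝ))

instance : Module ℝ A2 := inferInstanceAs (Module ℝ (ℝ × ℝ))

theorem ext {a b : A2} (h₁ : a.1 = b.1) (h₂ : a.2 = b.2) : a = b := Prod.ext h₁ h₂

instance : LieRing A2 where
  bracket a b := (a.1 * b.2 - a.2 * b.1, 0)
  add_lie a b c := ext (show (a.1 + b.1) * c.2 - (a.2 + b.2) * c.1 =
    (a.1 * c.2 - a.2 * c.1) + (b.1 * c.2 - b.2 * c.1) by ring) (add_zero (0 : ℝ)).symm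
  lie_add a b c := ext (show a.1 * (b.2 + c.2) - a.2 * (b.1 + c.1) =
    (a.1 * b.2 - a.2 * b.1) + (a.1 * c.2 - a.2 * c.1) by ring) (add_zero (0 : ℝ)).symm
  lie_self a := ext (show a.1 * a.2 - a.2 * a.1 = 0 by ring) rfl
  leibniz_lie a b c := ext (show a.1 * 0 - a.2 * (b.1 * c.2 - b.2 * c.1) =
    ((a.1 * b.2 - a.2 * b.1) * c.2 - 0 * c.1) +
      (b.1 * 0 - b.2 * (a.1 * c.2 - a.2 * c.1)) by ring) (add_zero (0 : ℝ)).symm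

instance : LieAlgebra ℝ A2 where
  lie_smul t a b := ext (show a.1 * (t * b.2) - a.2 * (t * b.1) =
    t * (a.1 * b.2 - a.2 * b.1) by ring) (mul_zero t).symm

end A2

/-- `sl(2, ℝ)`, the trace-free real `2 × 2` matrices with the commutator. -/
abbrev Sl2 : Type := LieAlgebra.SpecialLinear.sl (Fin 2) ℝ

end LiePointSymmetry

end

open LiePointSymmetry

noncomputable section

namespace LiePointSymmetry

/-! ### Partial derivatives -/

/-! Write `n = N + 2`. Since `y ≠ 0`, the equation can be solved for `y^(n+1)`, and at fixed `(x,
y)` the invariance condition becomes a polynomial identity in `y', …, y^(n)`. Its coefficients are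
the determining equations. They are extracted without expanding the prolongation: the condition is
evaluated at jets with very few nonzero coordinates, and a coefficient is isolated by finite
differences. This rests on the recursion `jetD` for `D^k f` (`totalDeriv_iterate`) and on the fact
that `D^k f` is affine in `y^(j)` when `k < 2j` (`jetD_add_single`).

The nonlinear terms of high order give `ξ_y = 0` and then `η_yy = 0`. The only exception is `n = 2`,
`α = 3`, where the equation is half of `(y²)''' = 0` and so linearisable; the theorem leaves this
case out. Once `ξ` depends on `x` alone and `η` is affine in `y`, the prolongation coefficients are
affine in the derivatives, and five monomials yield `linear_determining_equations`. If `α = 0`, they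
say `η_xy = (n/2) ξ_xx`. If `α ≠ 0`, they say `η = y η_y`, `η_xy = ((n-1)/2) ξ_xx` and `(α(n-1) -
(n+1)) ξ_xx = 0`, which singles out the special value of `α`. When `ξ_xx` is not forced to vanish,
the coefficient of `y^(n-1)` gives `η_xxy = ((n-1)/3) ξ_xxx`, incompatible with the previous
relation unless `ξ_xxx = 0`. On a connected `U` the field is therefore `P ∂_x + ((m P' + c) y + R)
∂_y` with polynomials of bounded degree (`exists_eq_affineField`). Conversely
`isLiePointSymmetry_affineField` checks such fields.

The Lie algebra structure comes from the opposite direction. Brackets of these fields are polynomial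
expressions (`lie_affineField`), so each abstract algebra maps to vector fields by an explicit
homomorphism. It is injective because `U` is open and nonempty, and its range is exactly the set of
fields found by the classification. -/

/-- The partial derivative `∂f/∂x`. -/
def dX (f : ℝ × ℝ → ℝ) (p : ℝ × ℝ) : ℝ := fderiv ℝ f p (1, 0)

/-- The partial derivative `∂f/∂y`. -/
def dY (f : ℝ × ℝ → ℝ) (p : ℝ × ℝ) : ℝ := fderiv ℝ f p (0, 1)

section Partial

variable {U : Opens (ℝ × ℝ)} {f g : ℝ × ℝ → ℝ} {p : ℝ × ℝ}

theorem contDiffOn_fderiv (hf : ContDiffOn ℝ ∞ f U) : ContDiffOn ℝ ∞ (fderiv ℝ f) U :=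
  hf.fderiv_of_isOpen U.isOpen (by simp)

theorem contDiffOn_dX (hf : ContDiffOn ℝ ∞ f U) : ContDiffOn ℝ ∞ (dX f) U :=
  (contDiffOn_fderiv hf).clm_apply contDiffOn_const

theorem contDiffOn_dY (hf : ContDiffOn ℝ ∞ f U) : ContDiffOn ℝ ∞ (dY f) U :=
  (contDiffOn_fderiv hf).clm_apply contDiffOn_const

theorem differentiableAt_of_contDiffOn (hf : ContDiffOn ℝ ∞ f U) (hp : p ∈ U) :
    DifferentiableAt ℝ f p :=
  (hf.contDiffAt (U.isOpen.mem_nhds hp)).differentiableAt (by simp)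

theorem eventuallyEq_of_eqOn (h : ∀ q ∈ U, f q = g q) (hp : p ∈ U) : f =ᶠ[nhds p] g :=
  Filter.eventuallyEq_of_mem (U.isOpen.mem_nhds hp) h

theorem dX_congr (h : ∀ q ∈ U, f q = g q) (hp : p ∈ U) : dX f p = dX g p := by
  rw [dX, dX, (eventuallyEq_of_eqOn h hp).fderiv_eq]

theorem dY_congr (h : ∀ q ∈ U, f q = g q) (hp : p ∈ U) : dY f p = dY g p := by
  rw [dY, dY, (eventuallyEq_of_eqOn h hp).fderiv_eq]

theorem dX_iterate_congr (h : ∀ q ∈ U, f q = g q) (k : ℕ) : ∀ q ∈ U, dX^[k] f q = dX^[k] g q := by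
  induction k with
  | zero => exact h
  | succ k ih =>
    intro q hq
    rw [Function.iterate_succ_apply', Function.iterate_succ_apply']
    exact dX_congr ih hq

theorem dX_const (c : ℝ) : dX (fun _ => c) = fun _ => 0 := by
  funext p; simp [dX]

theorem dY_const (c : ℝ) : dY (fun _ => c) = fun _ => 0 := by
  funext p; simp [dY]

theorem dX_iterate_zero (k : ℕ) : dX^[k] (fun _ => (0 : ℝ)) = fun _ => 0 :=
  Function.iterate_fixed (dX_const 0) k

theorem dX_eq_zero (h : ∀ q ∈ U, f q = 0) (hp : p ∈ U) : dX f p = 0 :=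
  (dX_congr (g := fun _ => 0) h hp).trans (by rw [dX_const])

theorem dY_eq_zero (h : ∀ q ∈ U, f q = 0) (hp : p ∈ U) : dY f p = 0 :=
  (dY_congr (g := fun _ => 0) h hp).trans (by rw [dY_const])

theorem dX_dY (hf : ContDiffOn ℝ ∞ f U) (hp : p ∈ U) : dX (dY f) p = dY (dX f) p := by
  have hd : DifferentiableAt ℝ (fderiv ℝ f) p :=
    ((contDiffOn_fderiv hf).contDiffAt (U.isOpen.mem_nhds hp)).differentiableAt (by simp)
  have hs : IsSymmSndFDerivAt ℝ f p :=
    (hf.contDiffAt (U.isOpen.mem_nhds hp)).isSymmSndFDerivAt (by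
      simpa using WithTop.coe_le_coe.2 (le_top : (2 : ℕ∞) ≤ ⊤))
  have key : ∀ v w : ℝ × ℝ,
      fderiv ℝ (fun q => fderiv ℝ f q v) p w = fderiv ℝ (fderiv ℝ f) p w v := by
    intro v w
    rw [fderiv_clm_apply hd (differentiableAt_const v)]
    simp
  change fderiv ℝ (fun q => fderiv ℝ f q (0, 1)) p (1, 0) =
    fderiv ℝ (fun q => fderiv ℝ f q (1, 0)) p (0, 1)
  rw [key, key]
  exact hs _ _

theorem dX_add (hf : DifferentiableAt ℝ f p) (hg : DifferentiableAt ℝ g p) :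
    dX (fun q => f q + g q) p = dX f p + dX g p := by
  simp only [dX]
  rw [fderiv_fun_add hf hg]; rfl

theorem dY_add (hf : DifferentiableAt ℝ f p) (hg : DifferentiableAt ℝ g p) :
    dY (fun q => f q + g q) p = dY f p + dY g p := by
  simp only [dY]
  rw [fderiv_fun_add hf hg]; rfl

theorem dX_mul (hf : DifferentiableAt ℝ f p) (hg : DifferentiableAt ℝ g p) :
    dX (fun q => f q * g q) p = f p * dX g p + g p * dX f p := by
  simp only [dX]
  rw [fderiv_fun_mul hf hg]; rfl

theorem dY_mul (hf : DifferentiableAt ℝ f p) (hg : DifferentiableAt ℝ g p) :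
    dY (fun q => f q * g q) p = f p * dY g p + g p * dY f p := by
  simp only [dY]
  rw [fderiv_fun_mul hf hg]; rfl

theorem dX_snd : dX Prod.snd = fun _ => 0 := by
  funext p; simp [dX, fderiv_snd]

theorem dY_snd : dY Prod.snd = fun _ => 1 := by
  funext p; simp [dY, fderiv_snd]

theorem dX_polynomial (P : Polynomial ℝ) :
    dX (fun p => P.eval p.1) = fun p => P.derivative.eval p.1 := by
  funext p
  have h : HasFDerivAt (fun p : ℝ × ℝ => P.eval p.1) _ p :=
    (P.hasDerivAt p.1).comp_hasFDerivAt p (hasFDerivAt_fst (𝕜 := ℝ) (p := p))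
  simp [dX, h.fderiv]

theorem dY_polynomial (P : Polynomial ℝ) : dY (fun p => P.eval p.1) = fun _ => 0 := by
  funext p
  have h : HasFDerivAt (fun p : ℝ × ℝ => P.eval p.1) _ p :=
    (P.hasDerivAt p.1).comp_hasFDerivAt p (hasFDerivAt_fst (𝕜 := ℝ) (p := p))
  simp [dY, h.fderiv]

theorem contDiff_polynomial (P : Polynomial ℝ) :
    ContDiff ℝ ∞ (fun p : ℝ × ℝ => P.eval p.1) := by
  have h : ContDiff ℝ ∞ (fun x : ℝ => P.eval x) := by
    simpa using P.contDiff_aeval (𝕜 := ℝ) ∞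
  exact h.comp contDiff_fst

theorem dX_iterate_polynomial (P : Polynomial ℝ) (k : ℕ) :
    dX^[k] (fun p => P.eval p.1) = fun p => (Polynomial.derivative^[k] P).eval p.1 := by
  induction k generalizing P with
  | zero => rfl
  | succ k ih => rw [Function.iterate_succ_apply, dX_polynomial, ih, Function.iterate_succ_apply]

/-- A smooth function on a connected open set with `f_y = 0` and `∂_x ^ m f = 0` is a polynomial in
`x` of degree less than `m`. -/
theorem exists_polynomial (hU : IsPreconnected (U : Set (ℝ × ℝ))) (m : ℕ) :
    ∀ f : ℝ × ℝ → ℝ, ContDiffOn ℝ ∞ f U → (∀ p ∈ U, dY f p = 0) → (∀ p ∈ U, dX^[m] f p = 0) →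
      ∃ P : Polynomial ℝ, P.degree < m ∧ ∀ p ∈ U, f p = P.eval p.1 := by
  induction m with
  | zero => exact fun f _ _ h => ⟨0, by simp, fun p hp => by simpa using h p hp⟩
  | succ m ih =>
    intro f hf hy hx
    obtain ⟨P, hPd, hP⟩ := ih (dX f) (contDiffOn_dX hf)
      (fun p hp => by rw [← dX_dY hf hp]; exact dX_eq_zero hy hp)
      (fun p hp => hx p hp)
    -- The termwise antiderivative of `P`; `P` represents `f_x` and has degree below `m`.
    let Q : Polynomial ℝ :=
      ∑ i ∈ Finset.range m, Polynomial.C (P.coeff i / (i + 1)) * Polynomial.X ^ (i + 1)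
    have hQP : Q.derivative = P := by
      have hPs : P = ∑ i ∈ Finset.range m, Polynomial.monomial i (P.coeff i) := by
        rcases m with _ | m
        · simpa using hPd
        · by_cases h0 : P = 0
          · simp [h0]
          · exact P.as_sum_range' _ ((Polynomial.natDegree_lt_iff_degree_lt h0).2 hPd)
      refine Eq.trans ?_ hPs.symm
      simp only [Q, Polynomial.derivative_sum]
      refine Finset.sum_congr rfl fun i _ => ?_
      rw [Polynomial.derivative_C_mul_X_pow, ← Polynomial.C_mul_X_pow_eq_monomial]
      have : ((i : ℝ) + 1) ≠ 0 := by positivity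
      simp [div_mul_cancel₀ _ this]
    have hQd : Q.degree < (m + 1 : ℕ) := by
      rw [← Polynomial.mem_degreeLT]
      refine Submodule.sum_mem _ fun i hi => Polynomial.mem_degreeLT.2 ?_
      refine (Polynomial.degree_C_mul_X_pow_le _ _).trans_lt ?_
      exact_mod_cast Nat.succ_lt_succ (Finset.mem_range.1 hi)
    have hdiff : ∀ p ∈ U, DifferentiableAt ℝ (fun q : ℝ × ℝ => Q.eval q.1) p := fun p _ =>
      (contDiff_polynomial Q).differentiable (by simp) p
    -- `f - Q` has both partial derivatives zero, so connectedness makes it one constant on all of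
    -- `U`.
    obtain ⟨a, ha⟩ := U.isOpen.exists_is_const_of_fderiv_eq_zero (𝕜 := ℝ)
      (f := fun q : ℝ × ℝ => f q - Q.eval q.1) hU
      (fun p hp => ((differentiableAt_of_contDiffOn hf hp).sub (hdiff p hp)).differentiableWithinAt)
      (fun p hp => by
        rw [fderiv_fun_sub (differentiableAt_of_contDiffOn hf hp) (hdiff p hp)]
        refine ContinuousLinearMap.ext fun v => ?_
        have hv : v = v.1 • (1, 0) + v.2 • (0, 1) := by ext <;> simp
        have h1 : fderiv ℝ f p (1, 0) = fderiv ℝ (fun q : ℝ × ℝ => Q.eval q.1) p (1, 0) := by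
          have := congrFun (dX_polynomial Q) p
          rw [hQP] at this
          exact (hP p hp).trans this.symm
        have h2 : fderiv ℝ f p (0, 1) = fderiv ℝ (fun q : ℝ × ℝ => Q.eval q.1) p (0, 1) :=
          (hy p hp).trans (congrFun (dY_polynomial Q) p).symm
        rw [hv, map_add, map_smul, map_smul, sub_apply,
          sub_apply, h1, h2]
        simp)
    refine ⟨Q + Polynomial.C a, ?_, fun p hp => ?_⟩
    · rw [← Polynomial.mem_degreeLT]
      refine Submodule.add_mem _ (Polynomial.mem_degreeLT.2 hQd) (Polynomial.mem_degreeLT.2 ?_)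
      exact Polynomial.degree_C_le.trans_lt (by exact_mod_cast m.succ_pos)
    · simp [← ha p hp]

end Partial

/-! ### A closed form of the iterated total derivative -/

/-- The shift direction `(1, y', y'', …)` of the total derivative. -/
def jetShift (J : Jet) : Jet := (1, fun k => J.2 (k + 1))

/-- The iterated total derivative `D ^ k f` of a function of `(x, y)`, expressed by a recursion that
differentiates `f` only. -/
def jetD : ℕ → (ℝ × ℝ → ℝ) → Jet → ℝ
  | 0, f, J => f (J.1, J.2 0)
  | k + 1, f, J => jetD k (dX f) J +
      ∑ i : Fin (k + 1), (k.choose i : ℝ) * (J.2 (i + 1) * jetD (k - i) (dY f) J)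
termination_by k => k
decreasing_by all_goals omega

theorem jetD_zero (f : ℝ × ℝ → ℝ) (J : Jet) : jetD 0 f J = f (J.1, J.2 0) := by
  rw [jetD]

theorem jetD_succ (k : ℕ) (f : ℝ × ℝ → ℝ) (J : Jet) : jetD (k + 1) f J = jetD k (dX f) J +
    ∑ i ∈ Finset.range (k + 1), (k.choose i : ℝ) * (J.2 (i + 1) * jetD (k - i) (dY f) J) := by
  rw [jetD, Finset.sum_range (fun i => (k.choose i : ℝ) * (J.2 (i + 1) * jetD (k - i) (dY f) J))]

section JetD

variable {U : Opens (ℝ × ℝ)} {f g : ℝ × ℝ → ℝ}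

theorem jetD_congr {J : Jet} (hJ : (J.1, J.2 0) ∈ U) (k : ℕ) (h : ∀ q ∈ U, f q = g q) :
    jetD k f J = jetD k g J := by
  induction k using Nat.strong_induction_on generalizing f g with
  | _ k ih =>
    cases k with
    | zero => rw [jetD_zero, jetD_zero]; exact h _ hJ
    | succ k =>
      rw [jetD_succ, jetD_succ, ih k (by omega) (fun q hq => dX_congr h hq)]
      congr 1
      refine Finset.sum_congr rfl fun i _ => ?_
      rw [ih (k - i) (by omega) (fun q hq => dY_congr h hq)]

theorem jetD_zero_fun (k : ℕ) (J : Jet) : jetD k (fun _ => 0) J = 0 := by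
  induction k using Nat.strong_induction_on with
  | _ k ih =>
    cases k with
    | zero => rw [jetD_zero]
    | succ k =>
      rw [jetD_succ, dX_const, dY_const, ih k (by omega), zero_add]
      refine Finset.sum_eq_zero fun i _ => ?_
      rw [ih (k - i) (by omega)]; ring

theorem jetD_eq_zero {J : Jet} (hJ : (J.1, J.2 0) ∈ U) (k : ℕ) (h : ∀ q ∈ U, f q = 0) :
    jetD k f J = 0 :=
  (jetD_congr hJ k (g := fun _ => 0) h).trans (jetD_zero_fun k J)

/-- The recursion for `jetD` is `D^(k+1) f = D^k (f_x + y' f_y)` with the product expanded by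
Leibniz. Differentiating it once more along the jet direction, factor by factor, reproduces the same
formula one order higher. -/
theorem hasLineDerivAt_jetD {J : Jet} (hJ : (J.1, J.2 0) ∈ U) (k : ℕ)
    (hf : ContDiffOn ℝ ∞ f U) :
    HasLineDerivAt ℝ (jetD k f) (jetD (k + 1) f J) J (jetShift J) := by
  induction k using Nat.strong_induction_on generalizing f with
  | _ k ih =>
    cases k with
    | zero =>
      have h1 : HasDerivAt (fun t : ℝ => (J.1 + t * 1, J.2 0 + t * J.2 1)) (1, J.2 1) 0 := by
        refine HasDerivAt.prodMk ?_ ?_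
        · simpa using (hasDerivAt_id (0 : ℝ)).const_add J.1
        · simpa using ((hasDerivAt_id (0 : ℝ)).mul_const (J.2 1)).const_add (J.2 0)
      have h2 : HasFDerivAt f (fderiv ℝ f (J.1, J.2 0)) (J.1 + (0 : ℝ) * 1, J.2 0 + 0 * J.2 1) := by
        simpa using (differentiableAt_of_contDiffOn hf hJ).hasFDerivAt
      have h3 := h2.comp_hasDerivAt (0 : ℝ) h1
      have hv : ((1, J.2 1) : ℝ × ℝ) = (1, 0) + J.2 1 • (0, 1) := by ext <;> simp
      rw [hv, map_add, map_smul] at h3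
      rw [HasLineDerivAt, jetD_succ]
      simp only [jetD_zero, zero_add, Finset.sum_range_one, Nat.choose_self, Nat.cast_one, one_mul,
        Nat.sub_zero]
      exact h3
    | succ k =>
      have hx := ih k (by omega) (contDiffOn_dX hf)
      have hd : HasLineDerivAt ℝ (jetD (k + 1) f) (jetD (k + 1) (dX f) J +
          ∑ i ∈ Finset.range (k + 1), (k.choose i : ℝ) * (J.2 (i + 2) * jetD (k - i) (dY f) J +
            J.2 (i + 1) * jetD (k - i + 1) (dY f) J)) J (jetShift J) := by
        have : ∀ i ∈ Finset.range (k + 1), HasDerivAt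
            (fun t : ℝ => (k.choose i : ℝ) * ((J + t • jetShift J).2 (i + 1) *
              jetD (k - i) (dY f) (J + t • jetShift J)))
            ((k.choose i : ℝ) * (J.2 (i + 2) * jetD (k - i) (dY f) J +
            J.2 (i + 1) * jetD (k - i + 1) (dY f) J)) 0 := by
          intro i _
          have h1 : HasDerivAt (fun t : ℝ => (J + t • jetShift J).2 (i + 1)) (J.2 (i + 2)) 0 := by
            simpa [jetShift] using
              ((hasDerivAt_id (0 : ℝ)).mul_const (J.2 (i + 2))).const_add (J.2 (i + 1))
          have h2 := ih (k - i) (by omega) (contDiffOn_dY hf)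
          have := (h1.mul h2).const_mul (k.choose i : ℝ)
          simpa using this
        have := hx.add (HasDerivAt.fun_sum this)
        rw [HasLineDerivAt]
        refine this.congr_of_eventuallyEq (Filter.Eventually.of_forall fun t => ?_)
        simp only [Pi.add_apply]
        rw [jetD_succ]
      convert hd using 1
      -- Pascal's rule splits the sum of order `k + 1` into the two sums produced by the product
      -- rule.
      rw [jetD_succ (k + 1), Finset.sum_choose_succ_mul
        (fun i j => J.2 (i + 1) * jetD j (dY f) J) k, ← Finset.sum_add_distrib]
      congr 1
      refine Finset.sum_congr rfl fun i hi => ?_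
      have : k + 1 - i = k - i + 1 := by have := Finset.mem_range.1 hi; omega
      rw [this]; ring

/-- A line derivative only sees the function near the base point on the line, and the line stays
over the open set `U` for small times; so the inductive identity, known only over `U`, suffices. -/
theorem totalDeriv_iterate (hf : ContDiffOn ℝ ∞ f U) (k : ℕ) {J : Jet}
    (hJ : (J.1, J.2 0) ∈ U) : totalDeriv^[k] (liftJet f) J = jetD k f J := by
  induction k generalizing J with
  | zero => rw [jetD_zero]; rfl
  | succ k ih =>
    rw [Function.iterate_succ_apply', totalDeriv]
    refine HasLineDerivAt.lineDeriv ?_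
    have h := hasLineDerivAt_jetD hJ k hf
    rw [HasLineDerivAt] at h ⊢
    refine h.congr_of_eventuallyEq ?_
    have hc : ContinuousAt (fun t : ℝ => (J.1 + t * 1, J.2 0 + t * J.2 1)) 0 := by fun_prop
    have hm : (U : Set (ℝ × ℝ)) ∈ nhds (J.1 + (0 : ℝ) * 1, J.2 0 + 0 * J.2 1) := by
      simpa using U.isOpen.mem_nhds hJ
    filter_upwards [hc hm] with t ht
    exact ih ht

end JetD

section Symmetry

variable {U : Opens (ℝ × ℝ)}

theorem contDiffOn_xi (X : VField U) : ContDiffOn ℝ ∞ X.xi U := X.2.1.fst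

theorem contDiffOn_eta (X : VField U) : ContDiffOn ℝ ∞ X.eta U := X.2.1.snd

theorem etaCoeff_eq (X : VField U) (k : ℕ) {J : Jet} (hJ : (J.1, J.2 0) ∈ U) :
    etaCoeff X k J = jetD k X.eta J -
      ∑ i ∈ Finset.Icc 1 k, (k.choose i : ℝ) * J.2 (k + 1 - i) * jetD i X.xi J := by
  rw [etaCoeff, totalDeriv_iterate (contDiffOn_eta X) k hJ]
  congr 1
  refine Finset.sum_congr rfl fun i _ => ?_
  rw [totalDeriv_iterate (contDiffOn_xi X) i hJ]

theorem lineDeriv_ode (n : ℕ) (α : ℝ) (J V : Jet) : lineDeriv ℝ (ode n α) J V =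
    V.2 0 * J.2 (n + 1) + J.2 0 * V.2 (n + 1) + α * (V.2 1 * J.2 n + J.2 1 * V.2 n) := by
  refine HasLineDerivAt.lineDeriv ?_
  have h : ∀ k, HasDerivAt (fun t : ℝ => (J + t • V).2 k) (V.2 k) 0 := fun k => by
    simpa using ((hasDerivAt_id (0 : ℝ)).mul_const (V.2 k)).const_add (J.2 k)
  have := ((h 0).fun_mul (h (n + 1))).fun_add (((h 1).const_mul α).fun_mul (h n))
  simp only [zero_smul, add_zero] at this
  exact this.congr_deriv (by ring)

theorem isLiePointSymmetry_ode_iff (n : ℕ) (α : ℝ) (X : VField U) :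
    IsLiePointSymmetry (ode n α) X ↔ ∀ (x : ℝ) (u : ℕ → ℝ), (x, u 0) ∈ U →
      u 0 * u (n + 1) + α * u 1 * u n = 0 →
      X.eta (x, u 0) * u (n + 1) + u 0 * etaCoeff X (n + 1) (x, u) +
        α * (etaCoeff X 1 (x, u) * u n + u 1 * etaCoeff X n (x, u)) = 0 := by
  have h0 : ∀ J : Jet, (prolong X J).2 0 = X.eta (J.1, J.2 0) := fun J => by
    simp [prolong, etaCoeff, liftJet]
  constructor
  · intro h x u hu ho
    have := h (x, u) hu ho
    rw [lineDeriv_ode, h0] at this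
    exact this
  · intro h J hJ ho
    rw [lineDeriv_ode, h0]
    exact h J.1 J.2 hJ ho

end Symmetry

/-! ### Dependence of the iterated total derivative on the jet coordinates -/

section JetShape

variable {U : Opens (ℝ × ℝ)} {f : ℝ × ℝ → ℝ} {x : ℝ} {u : ℕ → ℝ}

theorem choose_mul_choose_sub (k i j : ℕ) :
    k.choose j * (k - j).choose i = k.choose i * (k - i).choose j := by
  have h1 := Nat.choose_mul (n := k) (Nat.le_add_left j i)
  have h2 := Nat.choose_mul (n := k) (Nat.le_add_right i j)
  rw [Nat.add_sub_cancel] at h1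
  rw [Nat.add_sub_cancel_left] at h2
  rw [← h1, ← h2, Nat.choose_symm_add]

/-- `D ^ k f` is affine in the coordinate `y^(j)` as soon as `k < 2 j`. -/
theorem jetD_add_single (hf : ContDiffOn ℝ ∞ f U) (hu : (x, u 0) ∈ U) {k j : ℕ} (hj : 1 ≤ j)
    (hk : k < 2 * j) (t : ℝ) : jetD k f (x, u + Pi.single j t) =
      jetD k f (x, u) + t * (k.choose j * jetD (k - j) (dY f) (x, u)) := by
  have hs : ∀ i, (u + Pi.single j t : ℕ → ℝ) i = u i + if i = j then t else 0 := fun i => by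
    rw [Pi.add_apply, Pi.single_apply]
  induction k using Nat.strong_induction_on generalizing f with
  | _ k ih =>
    cases k with
    | zero =>
      rw [jetD_zero, jetD_zero, Nat.choose_eq_zero_of_lt (by omega)]
      simp [hs, show (0 : ℕ) ≠ j by omega]
    | succ k =>
      -- `y^(j)` enters a summand either inside `D^(k-i) f_y` or, if `i + 1 = j`, through the
      -- explicit factor. It cannot do both: in the second case `k - i < j` by the bound on the
      -- order, so no quadratic term in `t` arises.
      have hterm : ∀ i ∈ Finset.range (k + 1), (k.choose i : ℝ) *
          ((u + Pi.single j t : ℕ → ℝ) (i + 1) * jetD (k - i) (dY f) (x, u + Pi.single j t)) =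
          (k.choose i : ℝ) * (u (i + 1) * jetD (k - i) (dY f) (x, u)) +
          t * ((k.choose i : ℝ) * (k - i).choose j *
            (u (i + 1) * jetD (k - i - j) (dY (dY f)) (x, u))) +
          if i + 1 = j then t * (k.choose i * jetD (k - i) (dY f) (x, u)) else 0 := by
        intro i _
        rw [hs, ih (k - i) (by omega) (contDiffOn_dY hf) (by omega)]
        split_ifs with h
        · rw [Nat.choose_eq_zero_of_lt (show k - i < j by omega)]
          push_cast; ring
        · ring
      have hpas : ((k + 1).choose j : ℝ) = k.choose (j - 1) + k.choose j := by
        obtain ⟨j, rfl⟩ : ∃ j', j = j' + 1 := ⟨j - 1, by omega⟩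
        rw [Nat.choose_succ_succ]; push_cast; simp
      have hdelta : (∑ i ∈ Finset.range (k + 1),
          if i + 1 = j then t * ((k.choose i : ℝ) * jetD (k - i) (dY f) (x, u)) else 0) =
          t * (k.choose (j - 1) * jetD (k + 1 - j) (dY f) (x, u)) := by
        by_cases hjk : j ≤ k + 1
        · rw [Finset.sum_eq_single_of_mem (j - 1) (Finset.mem_range.2 (by omega))
            (fun i _ hi => if_neg (by omega)), if_pos (by omega),
            show k - (j - 1) = k + 1 - j by omega]
        · rw [Finset.sum_eq_zero fun i hi => if_neg (by have := Finset.mem_range.1 hi; omega),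
            Nat.choose_eq_zero_of_lt (show k < j - 1 by omega)]
          push_cast; ring
      -- The coefficients of `t` match after Pascal's rule once `D^(k+1-j) f_y` is unrolled by one
      -- step; the binomials are exchanged by `choose_mul_choose_sub`. For `j > k` everything
      -- vanishes.
      have hmain : (k.choose j : ℝ) * jetD (k + 1 - j) (dY f) (x, u) =
          k.choose j * jetD (k - j) (dY (dX f)) (x, u) +
          ∑ i ∈ Finset.range (k + 1), (k.choose i : ℝ) * (k - i).choose j *
            (u (i + 1) * jetD (k - i - j) (dY (dY f)) (x, u)) := by
        by_cases hjk : j ≤ k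
        · rw [show k + 1 - j = k - j + 1 by omega, jetD_succ,
            jetD_congr hu (k - j) (fun q hq => dX_dY hf hq), mul_add, Finset.mul_sum]
          congr 1
          rw [← Finset.sum_subset (Finset.range_subset_range.2 (show k - j + 1 ≤ k + 1 by omega))]
          · refine Finset.sum_congr rfl fun i hi => ?_
            have hi' := Finset.mem_range.1 hi
            rw [show k - i - j = k - j - i by omega, ← mul_assoc]
            congr 1
            exact_mod_cast choose_mul_choose_sub k i j
          · intro i _ hi
            have hi' : ¬ i < k - j + 1 := fun h => hi (Finset.mem_range.2 h)
            rw [Nat.choose_eq_zero_of_lt (show k - i < j by omega)]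
            push_cast; ring
        · rw [Nat.choose_eq_zero_of_lt (by omega), Finset.sum_eq_zero]
          · push_cast; ring
          · intro i _
            rw [Nat.choose_eq_zero_of_lt (show k - i < j by omega)]
            push_cast; ring
      rw [jetD_succ, jetD_succ, ih k (by omega) (contDiffOn_dX hf) (by omega),
        Finset.sum_congr rfl hterm, Finset.sum_add_distrib, Finset.sum_add_distrib, hdelta, hpas,
        ← Finset.mul_sum]
      linear_combination (-t) * hmain

theorem dY_dX_eq_zero (hf : ContDiffOn ℝ ∞ f U) (hy : ∀ p ∈ U, dY f p = 0) :
    ∀ p ∈ U, dY (dX f) p = 0 := fun p hp => by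
  rw [← dX_dY hf hp]; exact dX_eq_zero hy hp

theorem jetD_of_dY_eq_zero (hf : ContDiffOn ℝ ∞ f U) (hy : ∀ p ∈ U, dY f p = 0)
    (hu : (x, u 0) ∈ U) (k : ℕ) : jetD k f (x, u) = dX^[k] f (x, u 0) := by
  induction k generalizing f with
  | zero => rw [jetD_zero]; rfl
  | succ k ih =>
    rw [jetD_succ, ih (contDiffOn_dX hf) (dY_dX_eq_zero hf hy), Finset.sum_eq_zero,
      Function.iterate_succ_apply, add_zero]
    intro i _
    rw [jetD_eq_zero hu _ hy]; ring

/-- Since `f_y` has no `y`-derivative, its total derivatives are plain `x`-derivatives, so each step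
of the recursion only adds terms linear in the jet coordinates. -/
theorem jetD_of_dY_dY_eq_zero (hf : ContDiffOn ℝ ∞ f U) (hy : ∀ p ∈ U, dY (dY f) p = 0)
    (hu : (x, u 0) ∈ U) (k : ℕ) : jetD k f (x, u) = dX^[k] f (x, u 0) +
      ∑ i ∈ Finset.range k, u (i + 1) * (k.choose (i + 1) * dX^[k - 1 - i] (dY f) (x, u 0)) := by
  induction k generalizing f with
  | zero => rw [jetD_zero]; simp
  | succ k ih =>
    have hyx : ∀ p ∈ U, dY (dY (dX f)) p = 0 := fun p hp => by
      rw [← dY_congr (fun q hq => dX_dY hf hq) hp]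
      exact dY_dX_eq_zero (contDiffOn_dY hf) hy p hp
    have hext : ∑ i ∈ Finset.range k,
        u (i + 1) * (k.choose (i + 1) * dX^[k - 1 - i] (dY (dX f)) (x, u 0)) =
        ∑ i ∈ Finset.range (k + 1),
          u (i + 1) * (k.choose (i + 1) * dX^[k - i] (dY f) (x, u 0)) := by
      rw [Finset.sum_range_succ, Nat.choose_succ_self]
      simp only [Nat.cast_zero, zero_mul, mul_zero, add_zero]
      refine Finset.sum_congr rfl fun i hi => ?_
      have hi' := Finset.mem_range.1 hi
      rw [show k - i = k - 1 - i + 1 by omega, Function.iterate_succ_apply,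
        dX_iterate_congr (fun q hq => dX_dY hf hq) _ _ hu]
    rw [jetD_succ, ih (contDiffOn_dX hf) hyx, hext, ← Function.iterate_succ_apply, add_assoc,
      ← Finset.sum_add_distrib]
    congr 1
    refine Finset.sum_congr rfl fun i _ => ?_
    rw [jetD_of_dY_eq_zero (contDiffOn_dY hf) hy hu, Nat.choose_succ_succ, Nat.add_sub_cancel]
    push_cast; ring

end JetShape

/-! ### Prolongations -/

section Prolongation

variable {U : Opens (ℝ × ℝ)} {X : VField U} {x : ℝ} {u : ℕ → ℝ}

/-- Reversing the sum by `i ↦ k - i` indexes it by the jet coordinate, so that a sparse jet leaves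
only a few summands. -/
theorem etaCoeff_eq_sum_range (hu : (x, u 0) ∈ U) (k : ℕ) :
    etaCoeff X k (x, u) = jetD k X.eta (x, u) -
      ∑ i ∈ Finset.range k, u (i + 1) * (k.choose i * jetD (k - i) X.xi (x, u)) := by
  rw [etaCoeff_eq X k hu]
  congr 1
  refine Finset.sum_bij' (fun i _ => k - i) (fun i _ => k - i) ?_ ?_ ?_ ?_ ?_
  · intro i hi; simp only [Finset.mem_Icc, Finset.mem_range] at *; omega
  · intro i hi; simp only [Finset.mem_Icc, Finset.mem_range] at *; omega
  · intro i hi; simp only [Finset.mem_Icc] at hi; omega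
  · intro i hi; simp only [Finset.mem_range] at hi; omega
  · intro i hi
    simp only [Finset.mem_Icc] at hi
    rw [Nat.choose_symm hi.2, show k - (k - i) = i by omega, show k - i + 1 = k + 1 - i by omega]
    ring

theorem sum_range_single (k m : ℕ) (t : ℝ) (g : ℕ → ℝ) :
    ∑ i ∈ Finset.range k, (Pi.single (m + 1) t : ℕ → ℝ) (i + 1) * g i =
      if m < k then t * g m else 0 := by
  simp [Pi.single_apply, ite_mul]

/-- The coefficient of `y^(i+1)` in the `k`-th prolongation coefficient of a field with `ξ_y = 0`
and `η_yy = 0`. -/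
def linCoeff (X : VField U) (k i : ℕ) (p : ℝ × ℝ) : ℝ :=
  k.choose (i + 1) * dX^[k - 1 - i] (dY X.eta) p - k.choose i * dX^[k - i] X.xi p

theorem etaCoeff_linear (hξ : ∀ p ∈ U, dY X.xi p = 0) (hη : ∀ p ∈ U, dY (dY X.eta) p = 0)
    (hu : (x, u 0) ∈ U) (k : ℕ) : etaCoeff X k (x, u) = dX^[k] X.eta (x, u 0) +
      ∑ i ∈ Finset.range k, u (i + 1) * linCoeff X k i (x, u 0) := by
  rw [etaCoeff_eq_sum_range hu, jetD_of_dY_dY_eq_zero (contDiffOn_eta X) hη hu, add_sub_assoc,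
    ← Finset.sum_sub_distrib]
  congr 1
  refine Finset.sum_congr rfl fun i _ => ?_
  rw [jetD_of_dY_eq_zero (contDiffOn_xi X) hξ hu, linCoeff]
  ring

end Prolongation

/-! ### The determining equations -/

section Determining

variable {U : Opens (ℝ × ℝ)} {X : VField U} {α : ℝ}

theorem jetD_one (f : ℝ × ℝ → ℝ) (x : ℝ) (u : ℕ → ℝ) :
    jetD 1 f (x, u) = dX f (x, u 0) + u 1 * dY f (x, u 0) := by
  simp [jetD_succ, jetD_zero]

theorem etaCoeff_one {x : ℝ} {u : ℕ → ℝ} (hu : (x, u 0) ∈ U) (h1 : u 1 = 0) :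
    etaCoeff X 1 (x, u) = dX X.eta (x, u 0) := by
  rw [etaCoeff_eq_sum_range hu, jetD_one]
  simp [h1]

/-- Here `n = N + 3`. Take `y'' = s`, `y^(n) = q` and `y' = y^(n+1) = 0`, which lies on the
equation. The product `s q` has too high a total order to occur in `D^(n+1) η`. It comes only from
`y'' D^n ξ` and `y^(n) D² ξ`, with coefficient a positive multiple of `-y ξ_y`. A mixed second
difference in `s` and `q` isolates it, whatever the dependence on `s` alone. -/
theorem dY_xi_eq_zero_of_three_le {N : ℕ} (hy : ∀ p ∈ U, p.2 ≠ 0)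
    (hX : IsLiePointSymmetry (ode (N + 3) α) X) : ∀ p ∈ U, dY X.xi p = 0 := by
  rintro ⟨x, y⟩ hp
  rw [isLiePointSymmetry_ode_iff] at hX
  let w : ℝ → ℕ → ℝ := fun s => Pi.single 0 y + Pi.single 2 s
  have hw0 : ∀ s, w s 0 = y := fun s => by simp [w]
  have hw1 : ∀ s, w s 1 = 0 := fun s => by simp [w]
  have hwU : ∀ s, (x, w s 0) ∈ U := fun s => by rwa [hw0]
  have hxi := contDiffOn_xi X
  have heta := contDiffOn_eta X
  have key : ∀ s q : ℝ, y * (jetD (N + 4) X.eta (x, w s) + q * ((N + 4 : ℕ) *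
        dX (dY X.eta) (x, y)) - ((N + 4 : ℕ) * s * (jetD (N + 3) X.xi (x, w s) +
        q * dY X.xi (x, y)) + (N + 4).choose (N + 2) * q * (jetD 2 X.xi (x, w 0) +
        s * dY X.xi (x, y)))) + α * (dX X.eta (x, y) * q) = 0 := by
    intro s q
    have h0 : (w s + Pi.single (N + 3) q : ℕ → ℝ) 0 = y := by simp [w]
    have h1 : (w s + Pi.single (N + 3) q : ℕ → ℝ) 1 = 0 := by simp [w]
    have h3 : (w s + Pi.single (N + 3) q : ℕ → ℝ) (N + 3) = q := by simp [w]
    have h4 : (w s + Pi.single (N + 3) q : ℕ → ℝ) (N + 4) = 0 := by simp [w]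
    have hU' : (x, (w s + Pi.single (N + 3) q : ℕ → ℝ) 0) ∈ U := by rwa [h0]
    have e1 : jetD (N + 4) X.eta (x, w s + Pi.single (N + 3) q) = _ :=
      jetD_add_single heta (hwU s) (by omega) (by omega) q
    have e2 : jetD (N + 3) X.xi (x, w s + Pi.single (N + 3) q) = _ :=
      jetD_add_single hxi (hwU s) (by omega) (by omega) q
    have e3 : jetD 2 X.xi (x, w s + Pi.single (N + 3) q) = _ :=
      jetD_add_single hxi (hwU s) (by omega) (by omega) q
    have e4 := jetD_add_single (k := 2) (j := 2) hxi (hwU 0) (by omega) (by omega) s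
    rw [show w 0 + Pi.single 2 s = w s by simp [w]] at e4
    rw [Nat.choose_eq_zero_of_lt (show 2 < N + 3 by omega), e4] at e3
    simp only [show N + 4 - (N + 3) = 1 by omega, Nat.sub_self, jetD_zero, jetD_one, hw0, hw1,
      Nat.choose_self, Nat.choose_succ_self_right] at e1 e2 e3
    have hsum : ∑ i ∈ Finset.range (N + 4), (w s + Pi.single (N + 3) q : ℕ → ℝ) (i + 1) *
        ((N + 4).choose i * jetD (N + 4 - i) X.xi (x, w s + Pi.single (N + 3) q)) =
        s * ((N + 4 : ℕ) * jetD (N + 3) X.xi (x, w s + Pi.single (N + 3) q)) +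
        q * ((N + 4).choose (N + 2) * jetD 2 X.xi (x, w s + Pi.single (N + 3) q)) := by
      simp only [w, Pi.add_apply, add_mul, Finset.sum_add_distrib, sum_range_single (N + 4) 1,
        sum_range_single (N + 4) (N + 2)]
      simp
    have := hX x _ hU' (by rw [h1, h4]; ring)
    rw [etaCoeff_one hU' h1, etaCoeff_eq_sum_range hU', hsum, e1, e2, e3, h0, h1, h3, h4] at this
    push_cast at this ⊢
    linear_combination this
  have hz : y * (((N + 4 : ℕ) + ((N + 4).choose (N + 2) : ℝ)) * dY X.xi (x, y)) = 0 := by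
    linear_combination (-1 : ℝ) * key 1 1 + key 1 0 + key 0 1 - key 0 0
  have hpos : ((N + 4 : ℕ) + ((N + 4).choose (N + 2) : ℝ)) ≠ 0 := by positivity
  have hy' : y ≠ 0 := hy _ hp
  exact ((mul_eq_zero.1 hz).resolve_left hy' |> mul_eq_zero.1).resolve_left hpos

/-- For `n = 2` the coordinates `y''` and `y^(n)` coincide, so the mixed term becomes the `q²` term,
read off by a symmetric second difference. -/
theorem dY_xi_eq_zero_of_two (hy : ∀ p ∈ U, p.2 ≠ 0)
    (hX : IsLiePointSymmetry (ode 2 α) X) : ∀ p ∈ U, dY X.xi p = 0 := by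
  rintro ⟨x, y⟩ hp
  rw [isLiePointSymmetry_ode_iff] at hX
  let w : ℕ → ℝ := Pi.single 0 y
  have hw0 : w 0 = y := by simp [w]
  have hw1 : w 1 = 0 := by simp [w]
  have hwU : (x, w 0) ∈ U := by rwa [hw0]
  have key : ∀ q : ℝ, y * (jetD 3 X.eta (x, w) + q * (3 * dX (dY X.eta) (x, y)) -
      3 * q * (jetD 2 X.xi (x, w) + q * dY X.xi (x, y))) + α * (dX X.eta (x, y) * q) = 0 := by
    intro q
    have h0 : (w + Pi.single 2 q : ℕ → ℝ) 0 = y := by simp [w]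
    have h1 : (w + Pi.single 2 q : ℕ → ℝ) 1 = 0 := by simp [w]
    have h2 : (w + Pi.single 2 q : ℕ → ℝ) 2 = q := by simp [w]
    have h3 : (w + Pi.single 2 q : ℕ → ℝ) 3 = 0 := by simp [w]
    have hU' : (x, (w + Pi.single 2 q : ℕ → ℝ) 0) ∈ U := by rwa [h0]
    have e1 : jetD 3 X.eta (x, w + Pi.single 2 q) = _ :=
      jetD_add_single (contDiffOn_eta X) hwU (by omega) (by omega) q
    have e2 : jetD 2 X.xi (x, w + Pi.single 2 q) = _ :=
      jetD_add_single (contDiffOn_xi X) hwU (by omega) (by omega) q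
    simp only [show 3 - 2 = 1 by omega, Nat.sub_self, jetD_zero, jetD_one, hw0, hw1,
      Nat.choose_self, Nat.choose_succ_self_right] at e1 e2
    have := hX x _ hU' (by rw [h1, h3]; ring)
    rw [etaCoeff_one hU' h1, etaCoeff_eq_sum_range hU', e1] at this
    simp only [Finset.sum_range_succ, Finset.sum_range_zero, zero_add, h0, h1, h2, h3, e2,
      Nat.reduceAdd, Nat.reduceSub, show Nat.choose 3 1 = 3 from rfl] at this
    push_cast at this
    linear_combination this
  have hz : y * dY X.xi (x, y) = 0 := by
    linear_combination (-1 / 6 : ℝ) * key 1 - (1 / 6) * key (-1) + (1 / 3) * key 0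
  have hy' : y ≠ 0 := hy _ hp
  simpa [hy'] using hz

/-- Here `n = N + 4`. With `y'' = s`, `y^(n-1) = q` and `y' = y^(n) = y^(n+1) = 0` the terms in `α`
disappear. As `D^k ξ` is now a pure `x`-derivative, the product `s q` comes only from `D^(n+1) η`,
with coefficient a binomial times `y η_yy`. The orders `2` and `n - 1` are distinct because `n ≥ 4`.
-/
theorem dY_dY_eta_eq_zero_of_four_le {N : ℕ} (hy : ∀ p ∈ U, p.2 ≠ 0)
    (hX : IsLiePointSymmetry (ode (N + 4) α) X) (hξ : ∀ p ∈ U, dY X.xi p = 0) :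
    ∀ p ∈ U, dY (dY X.eta) p = 0 := by
  rintro ⟨x, y⟩ hp
  rw [isLiePointSymmetry_ode_iff] at hX
  let w : ℝ → ℕ → ℝ := fun s => Pi.single 0 y + Pi.single 2 s
  have hw0 : ∀ s, w s 0 = y := fun s => by simp [w]
  have hwU : ∀ s, (x, w s 0) ∈ U := fun s => by rwa [hw0]
  have heta := contDiffOn_eta X
  have key : ∀ s q : ℝ, y * (jetD (N + 5) X.eta (x, w s) + q * ((N + 5).choose (N + 3) *
      (jetD 2 (dY X.eta) (x, w 0) + s * dY (dY X.eta) (x, y))) -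
      (s * ((N + 5 : ℕ) * dX^[N + 4] X.xi (x, y)) +
        q * ((N + 5).choose (N + 2) * dX^[3] X.xi (x, y)))) = 0 := by
    intro s q
    have h0 : (w s + Pi.single (N + 3) q : ℕ → ℝ) 0 = y := by simp [w]
    have h1 : (w s + Pi.single (N + 3) q : ℕ → ℝ) 1 = 0 := by simp [w]
    have h3 : (w s + Pi.single (N + 3) q : ℕ → ℝ) (N + 4) = 0 := by simp [w]
    have h4 : (w s + Pi.single (N + 3) q : ℕ → ℝ) (N + 5) = 0 := by simp [w]
    have hU' : (x, (w s + Pi.single (N + 3) q : ℕ → ℝ) 0) ∈ U := by rwa [h0]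
    have e1 : jetD (N + 5) X.eta (x, w s + Pi.single (N + 3) q) = _ :=
      jetD_add_single heta (hwU s) (by omega) (by omega) q
    have e4 := jetD_add_single (k := 2) (j := 2) (contDiffOn_dY heta) (hwU 0) (by omega)
      (by omega) s
    rw [show w 0 + Pi.single 2 s = w s by simp [w]] at e4
    simp only [show N + 5 - (N + 3) = 2 by omega, e4, Nat.sub_self, jetD_zero, hw0,
      Nat.choose_self] at e1
    have hsum : ∑ i ∈ Finset.range (N + 5), (w s + Pi.single (N + 3) q : ℕ → ℝ) (i + 1) *
        ((N + 5).choose i * jetD (N + 5 - i) X.xi (x, w s + Pi.single (N + 3) q)) =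
        s * ((N + 5 : ℕ) * dX^[N + 4] X.xi (x, y)) +
        q * ((N + 5).choose (N + 2) * dX^[3] X.xi (x, y)) := by
      simp only [jetD_of_dY_eq_zero (contDiffOn_xi X) hξ hU', h0]
      simp only [w, Pi.add_apply, add_mul, Finset.sum_add_distrib, sum_range_single (N + 5) 1,
        sum_range_single (N + 5) (N + 2)]
      simp
    have := hX x _ hU' (by rw [h1, h4]; ring)
    rw [etaCoeff_one hU' h1, etaCoeff_eq_sum_range hU', hsum, e1, h0, h1, h3, h4] at this
    push_cast at this ⊢
    linear_combination this
  have hz : y * (((N + 5).choose (N + 3) : ℝ) * dY (dY X.eta) (x, y)) = 0 := by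
    linear_combination key 1 1 - key 1 0 - key 0 1 + key 0 0
  have hpos : ((N + 5).choose (N + 3) : ℝ) ≠ 0 := by
    exact_mod_cast (Nat.choose_pos (by omega)).ne'
  have hy' : y ≠ 0 := hy _ hp
  exact ((mul_eq_zero.1 hz).resolve_left hy' |> mul_eq_zero.1).resolve_left hpos

/-- For `n = 3` the orders `2` and `n - 1` coincide, and `η_yy` is found in the coefficient of
`(y'')²`. -/
theorem dY_dY_eta_eq_zero_of_three (hy : ∀ p ∈ U, p.2 ≠ 0)
    (hX : IsLiePointSymmetry (ode 3 α) X) (hξ : ∀ p ∈ U, dY X.xi p = 0) :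
    ∀ p ∈ U, dY (dY X.eta) p = 0 := by
  rintro ⟨x, y⟩ hp
  rw [isLiePointSymmetry_ode_iff] at hX
  let w : ℕ → ℝ := Pi.single 0 y
  have hw0 : w 0 = y := by simp [w]
  have hw1 : w 1 = 0 := by simp [w]
  have hwU : (x, w 0) ∈ U := by rwa [hw0]
  have heta := contDiffOn_eta X
  have key : ∀ s : ℝ, y * (jetD 3 (dX X.eta) (x, w) + s * (3 * dX (dY (dX X.eta)) (x, y)) +
      3 * s * (jetD 2 (dY X.eta) (x, w) + s * dY (dY X.eta) (x, y)) -
      s * (4 * dX^[3] X.xi (x, y))) = 0 := by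
    intro s
    have h0 : (w + Pi.single 2 s : ℕ → ℝ) 0 = y := by simp [w]
    have h1 : (w + Pi.single 2 s : ℕ → ℝ) 1 = 0 := by simp [w]
    have h2 : (w + Pi.single 2 s : ℕ → ℝ) 2 = s := by simp [w]
    have h3 : (w + Pi.single 2 s : ℕ → ℝ) 3 = 0 := by simp [w]
    have h4 : (w + Pi.single 2 s : ℕ → ℝ) 4 = 0 := by simp [w]
    have hU' : (x, (w + Pi.single 2 s : ℕ → ℝ) 0) ∈ U := by rwa [h0]
    have e1 : jetD 3 (dX X.eta) (x, w + Pi.single 2 s) = _ :=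
      jetD_add_single (contDiffOn_dX heta) hwU (by omega) (by omega) s
    have e2 : jetD 2 (dY X.eta) (x, w + Pi.single 2 s) = _ :=
      jetD_add_single (contDiffOn_dY heta) hwU (by omega) (by omega) s
    simp only [show 3 - 2 = 1 by omega, Nat.sub_self, jetD_zero, jetD_one, hw0, hw1,
      Nat.choose_self, Nat.choose_succ_self_right] at e1 e2
    -- `D⁴ η` is quadratic in `y''`, so `jetD_add_single` does not apply to it; one unrolling leaves
    -- derivatives of order at most three, which are affine.
    have e3 := jetD_succ 3 X.eta (x, w + Pi.single 2 s)
    simp only [Finset.sum_range_succ, Finset.sum_range_zero, zero_add, h1, h2, h3, h4, e1, e2,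
      Nat.reduceAdd, Nat.reduceSub, show Nat.choose 3 1 = 3 from rfl] at e3
    have := hX x _ hU' (by rw [h1, h4]; ring)
    rw [etaCoeff_one hU' h1, etaCoeff_eq_sum_range hU', e3] at this
    simp only [jetD_of_dY_eq_zero (contDiffOn_xi X) hξ hU'] at this
    simp only [Finset.sum_range_succ, Finset.sum_range_zero, zero_add, h0, h1, h2, h3, h4,
      Nat.reduceAdd, Nat.reduceSub, show Nat.choose 4 1 = 4 from rfl] at this
    push_cast at this
    linear_combination this
  have hz : y * dY (dY X.eta) (x, y) = 0 := by
    linear_combination (1 / 6 : ℝ) * key 1 + (1 / 6) * key (-1) - (1 / 3) * key 0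
  have hy' : y ≠ 0 := hy _ hp
  simpa [hy'] using hz

/-- For `n = 2` no single coefficient gives `η_yy = 0`. The coefficients of `y' y''` and `y'^3` give
two relations, and eliminating `η_yyy` after a `y`-derivative leaves `(6 - 2α) y η_yy = 0`. For `α =
3` the conclusion fails: the equation is linear in `y²`, and `(1/y) ∂_y` is a symmetry. -/
theorem dY_dY_eta_eq_zero_of_two (hα : α ≠ 3) (hy : ∀ p ∈ U, p.2 ≠ 0)
    (hX : IsLiePointSymmetry (ode 2 α) X) (hξ : ∀ p ∈ U, dY X.xi p = 0) :
    ∀ p ∈ U, dY (dY X.eta) p = 0 := by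
  rw [isLiePointSymmetry_ode_iff] at hX
  have heta := contDiffOn_eta X
  have both : ∀ q ∈ U, (α * (q.2 * dY X.eta q + -1 * X.eta q) +
      3 * (q.2 * q.2) * dY (dY X.eta) q = 0) ∧
      q.2 * dY (dY (dY X.eta)) q + α * dY (dY X.eta) q = 0 := by
    rintro ⟨x, y⟩ hp
    have hy' : y ≠ 0 := hy _ hp
    -- With `y' = p` and `y'' = q`, the choice `y''' = ρ p q` puts the jet on the equation.
    obtain ⟨ρ, hρ⟩ : ∃ ρ : ℝ, y * ρ = -α := ⟨-α / y, by field_simp⟩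
    have key : ∀ p q : ℝ, X.eta (x, y) * (ρ * p * q) + y * etaCoeff X 3
        (x, Pi.single 0 y + Pi.single 1 p + Pi.single 2 q + Pi.single 3 (ρ * p * q)) +
        α * (etaCoeff X 1
        (x, Pi.single 0 y + Pi.single 1 p + Pi.single 2 q + Pi.single 3 (ρ * p * q)) * q +
        p * etaCoeff X 2
        (x, Pi.single 0 y + Pi.single 1 p + Pi.single 2 q + Pi.single 3 (ρ * p * q))) = 0 := by
      intro p q
      have := hX x (Pi.single 0 y + Pi.single 1 p + Pi.single 2 q + Pi.single 3 (ρ * p * q))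
        (by simpa using hp) (by simp; linear_combination p * q * hρ)
      simpa using this
    have hexp : ∀ p q r : ℝ,
        etaCoeff X 1 (x, Pi.single 0 y + Pi.single 1 p + Pi.single 2 q + Pi.single 3 r) =
          dX X.eta (x, y) + p * dY X.eta (x, y) - p * dX X.xi (x, y) ∧
        etaCoeff X 2 (x, Pi.single 0 y + Pi.single 1 p + Pi.single 2 q + Pi.single 3 r) =
          dX (dX X.eta) (x, y) + p * dY (dX X.eta) (x, y) + p * (dX (dY X.eta) (x, y) +
          p * dY (dY X.eta) (x, y)) + q * dY X.eta (x, y) - p * dX (dX X.xi) (x, y)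
          - 2 * q * dX X.xi (x, y) := by
      intro p q r
      have hU' : (x, (Pi.single 0 y + Pi.single 1 p + Pi.single 2 q + Pi.single 3 r :
        ℕ → ℝ) 0) ∈ U := by simpa using hp
      constructor
      · rw [etaCoeff_eq_sum_range hU']
        simp only [jetD_of_dY_eq_zero (contDiffOn_xi X) hξ hU']
        simp [jetD_succ, jetD_zero]
      · rw [etaCoeff_eq_sum_range hU']
        simp only [jetD_of_dY_eq_zero (contDiffOn_xi X) hξ hU']
        simp [jetD_succ, jetD_zero, Finset.sum_range_succ]
        ring
    -- Only the coefficients of `p³`, `p q` and `r` matter; the finite differences below cancel the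
    -- constants left unnamed.
    obtain ⟨c0, c1, c2, d0, d1, hexp3⟩ : ∃ c0 c1 c2 d0 d1 : ℝ, ∀ p q r : ℝ,
        etaCoeff X 3 (x, Pi.single 0 y + Pi.single 1 p + Pi.single 2 q + Pi.single 3 r) =
          c0 + c1 * p + c2 * p ^ 2 + dY (dY (dY X.eta)) (x, y) * p ^ 3 +
          3 * p * q * dY (dY X.eta) (x, y) + d0 * q + r * dY X.eta (x, y)
          - 3 * r * dX X.xi (x, y) := by
      refine ⟨dX (dX (dX X.eta)) (x, y), dY (dX (dX X.eta)) (x, y) + dX (dY (dX X.eta)) (x, y) +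
        dX (dX (dY X.eta)) (x, y) - dX (dX (dX X.xi)) (x, y), dY (dY (dX X.eta)) (x, y) +
        dY (dX (dY X.eta)) (x, y) + dX (dY (dY X.eta)) (x, y), dY (dX X.eta) (x, y) +
        2 * dX (dY X.eta) (x, y) - 3 * dX (dX X.xi) (x, y), 0, ?_⟩
      intro p q r
      have hU' : (x, (Pi.single 0 y + Pi.single 1 p + Pi.single 2 q + Pi.single 3 r :
        ℕ → ℝ) 0) ∈ U := by simpa using hp
      rw [etaCoeff_eq_sum_range hU']
      simp only [jetD_of_dY_eq_zero (contDiffOn_xi X) hξ hU']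
      simp [jetD_succ, jetD_zero, Finset.sum_range_succ]
      ring
    simp only [(hexp _ _ _).1, (hexp _ _ _).2, hexp3] at key
    constructor
    -- The mixed difference picks out `p q`; the next bullet uses a third difference in `p` at `q =
    -- 0` to pick out `p³`.
    · linear_combination y * (key 1 1 - key 1 0 - key 0 1 + key 0 0) -
        (X.eta (x, y) + y * dY X.eta (x, y) - 3 * y * dX X.xi (x, y)) * hρ
    · linear_combination (1 / 6 : ℝ) * key 2 0 - (1 / 2) * key 1 0 + (1 / 2) * key 0 0 -
        (1 / 6) * key (-1) 0
  intro p hp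
  have hd := dY_eq_zero (fun q hq => (both q hq).1) hp
  have d0 := differentiableAt_of_contDiffOn heta hp
  have d1 := differentiableAt_of_contDiffOn (contDiffOn_dY heta) hp
  have d2 := differentiableAt_of_contDiffOn (contDiffOn_dY (contDiffOn_dY heta)) hp
  have ds : DifferentiableAt ℝ (Prod.snd : ℝ × ℝ → ℝ) p := differentiableAt_snd
  have hc : ∀ c : ℝ, DifferentiableAt ℝ (fun _ : ℝ × ℝ => c) p := fun c =>
    differentiableAt_const c
  rw [dY_add ((hc α).fun_mul ((ds.fun_mul d1).fun_add ((hc _).fun_mul d0)))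
      (((hc 3).fun_mul (ds.fun_mul ds)).fun_mul d2),
    dY_mul (hc α) ((ds.fun_mul d1).fun_add ((hc _).fun_mul d0)),
    dY_add (ds.fun_mul d1) ((hc _).fun_mul d0), dY_mul ds d1, dY_mul (hc _) d0,
    dY_mul ((hc 3).fun_mul (ds.fun_mul ds)) d2, dY_mul (hc 3) (ds.fun_mul ds), dY_mul ds ds] at hd
  simp only [dY_const, dY_snd] at hd
  have h3 := (both p hp).2
  have hy' := hy p hp
  -- The `y`-derivative of the first relation is `(α + 6) y η_yy + 3 y² η_yyy = 0`; subtracting `3y`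
  -- times the second removes `η_yyy`.
  have : p.2 * ((6 - 2 * α) * dY (dY X.eta) p) = 0 := by
    linear_combination hd - 3 * p.2 * h3
  have hα' : 6 - 2 * α ≠ 0 := fun h => hα (by linarith)
  exact ((mul_eq_zero.1 this).resolve_left hy' |> mul_eq_zero.1).resolve_left hα'

end Determining

/-! ### Determining equations for `ξ = ξ(x)` and `η` affine in `y` -/

section Linear

variable {U : Opens (ℝ × ℝ)} {X : VField U} {α : ℝ} {N : ℕ}

/-- The jet coordinates with prescribed `y`, `y'`, `y^(N+1)`, `y^(N+2)` and `y^(N+3)`; for `N = 0`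
the second and third contributions add up. -/
def sparseJet (N : ℕ) (y p v q r : ℝ) : ℕ → ℝ :=
  Pi.single 0 y + Pi.single 1 p + Pi.single (N + 1) v + Pi.single (N + 2) q + Pi.single (N + 3) r

theorem sum_sparseJet (N k : ℕ) (y p v q r : ℝ) (g : ℕ → ℝ) :
    ∑ i ∈ Finset.range k, sparseJet N y p v q r (i + 1) * g i =
      (if 0 < k then p * g 0 else 0) + (if N < k then v * g N else 0) +
      (if N + 1 < k then q * g (N + 1) else 0) + (if N + 2 < k then r * g (N + 2) else 0) := by
  simp only [sparseJet, Pi.add_apply, add_mul, Finset.sum_add_distrib, sum_range_single k N,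
    sum_range_single k (N + 1), sum_range_single k (N + 2), sum_range_single k 0 p g]
  simp

theorem linCoeff_sub_one (X : VField U) (k : ℕ) (p : ℝ × ℝ) :
    linCoeff X (k + 1) k p = dY X.eta p - ((k + 1 : ℕ) : ℝ) * dX X.xi p := by
  simp [linCoeff]

/-- The equations satisfied by a symmetry with `ξ_y = 0` and `η_yy = 0`, obtained from the
coefficients of the jet monomials `1`, `y^(n)`, `y^(n-1)`, `y' y^(n-1)` and `y' y^(n)`. -/
theorem linear_determining_equations (hy : ∀ p ∈ U, p.2 ≠ 0)
    (hX : IsLiePointSymmetry (ode (N + 2) α) X) (hξ : ∀ p ∈ U, dY X.xi p = 0)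
    (hη : ∀ p ∈ U, dY (dY X.eta) p = 0) : ∀ p ∈ U,
    dX^[N + 3] X.eta p = 0 ∧
    p.2 * linCoeff X (N + 3) (N + 1) p + α * dX X.eta p = 0 ∧
    (1 ≤ N ∨ α = 0 → linCoeff X (N + 3) N p = 0) ∧
    α * linCoeff X (N + 2) N p = 0 ∧
    α * (p.2 * dY X.eta p - X.eta p) = 0 := by
  rintro ⟨x, y⟩ hp
  have hy' : y ≠ 0 := hy _ hp
  obtain ⟨ρ, hρ⟩ : ∃ ρ : ℝ, y * ρ = -α := ⟨-α / y, by field_simp⟩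
  rw [isLiePointSymmetry_ode_iff] at hX
  have h0 : ∀ p v q r, sparseJet N y p v q r 0 = y := fun p v q r => by simp [sparseJet]
  have hq : ∀ p v q r, sparseJet N y p v q r (N + 2) = q := fun p v q r => by simp [sparseJet]
  have hr : ∀ p v q r, sparseJet N y p v q r (N + 3) = r := fun p v q r => by simp [sparseJet]
  have h1 : ∀ p q r, sparseJet N y p 0 q r 1 = p := fun p q r => by simp [sparseJet]
  have h1v : ∀ p v, 1 ≤ N → sparseJet N y p v 0 0 1 = p := fun p v hN => by
    have : N ≠ 0 := by omega
    simp [sparseJet, this]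
  have h1w : ∀ p v, N = 0 → sparseJet N y p v 0 0 1 = p + v := fun p v hN => by
    simp [sparseJet, hN]
  have hU' : ∀ p v q r, (x, sparseJet N y p v q r 0) ∈ U := fun p v q r => by rwa [h0]
  have c1 : ∀ p v q r, etaCoeff X 1 (x, sparseJet N y p v q r) =
      dX X.eta (x, y) + sparseJet N y p v q r 1 * linCoeff X 1 0 (x, y) := fun p v q r => by
    rw [etaCoeff_linear hξ hη (hU' p v q r), h0]
    simp
  have c2 : ∀ p v q r, etaCoeff X (N + 2) (x, sparseJet N y p v q r) =
      dX^[N + 2] X.eta (x, y) + (p * linCoeff X (N + 2) 0 (x, y) + v * linCoeff X (N + 2) N (x, y) +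
        q * linCoeff X (N + 2) (N + 1) (x, y)) := fun p v q r => by
    rw [etaCoeff_linear hξ hη (hU' p v q r), h0, sum_sparseJet]
    simp
  have c3 : ∀ p v q r, etaCoeff X (N + 3) (x, sparseJet N y p v q r) =
      dX^[N + 3] X.eta (x, y) + (p * linCoeff X (N + 3) 0 (x, y) + v * linCoeff X (N + 3) N (x, y) +
        q * linCoeff X (N + 3) (N + 1) (x, y) + r * linCoeff X (N + 3) (N + 2) (x, y)) :=
    fun p v q r => by
    rw [etaCoeff_linear hξ hη (hU' p v q r), h0, sum_sparseJet]
    simp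
  have hE : ∀ p v q r, y * r + α * sparseJet N y p v q r 1 * q = 0 → _ := fun p v q r h =>
    hX x _ (hU' p v q r) (by rw [h0, hq, hr]; exact h)
  simp only [h0, hq, hr, c1, c2, c3] at hE
  have E0 := hE 0 0 0 0 (by ring)
  have hR0 : dX^[N + 3] X.eta (x, y) = 0 := by
    rw [h1] at E0
    have : y * dX^[N + 3] X.eta (x, y) = 0 := by linear_combination E0
    exact (mul_eq_zero.1 this).resolve_left hy'
  rw [hR0] at hE
  refine ⟨hR0, ?_, ?_, ?_, ?_⟩
  · have E1 := hE 0 0 1 0 (by rw [h1]; ring)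
    rw [h1] at E1
    linear_combination E1
  -- If `n = 2`, then `y^(n-1)` is `y'`, and its coefficient also contains `α ∂_x^n η`. Hence the
  -- requirement `N ≥ 1` or `α = 0`.
  · intro hN
    have E1 := hE 0 1 0 0 (by ring)
    have : y * linCoeff X (N + 3) N (x, y) = 0 := by
      rcases hN with hN | rfl
      · rw [h1v _ _ hN] at E1
        linear_combination E1
      · linear_combination E1
    exact (mul_eq_zero.1 this).resolve_left hy'
  · have E1 := fun p v => hE p v 0 0 (by ring)
    rcases Nat.eq_zero_or_pos N with hN | hN
    -- For `n = 2` the monomial `y' y^(n-1)` is `y'^2`, so the even part in `v` replaces the mixed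
    -- difference.
    · simp only [h1w _ _ hN] at E1
      linear_combination (1 / 2 : ℝ) * E1 0 1 + (1 / 2 : ℝ) * E1 0 (-1)
    · simp only [h1v _ _ hN] at E1
      linear_combination E1 1 1 - E1 1 0 - E1 0 1 + E1 0 0
  -- Only here is `y^(n+1)` nonzero: the equation forces the value `ρ p q`. In the coefficient of
  -- `y' y^(n)` the terms in `ξ_x` then cancel.
  · have E1 := fun p q => hE p 0 q (ρ * p * q) (by rw [h1]; linear_combination p * q * hρ)
    simp only [h1] at E1
    rw [linCoeff_sub_one X (N + 2), linCoeff_sub_one X (N + 1), linCoeff_sub_one X 0] at E1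
    push_cast at E1
    linear_combination y * (E1 1 1 - E1 1 0 - E1 0 1 + E1 0 0) -
      (X.eta (x, y) + y * dY X.eta (x, y) - (N + 3) * y * dX X.xi (x, y)) * hρ

theorem dY_xi_eq_zero (hy : ∀ p ∈ U, p.2 ≠ 0) (hX : IsLiePointSymmetry (ode (N + 2) α) X) :
    ∀ p ∈ U, dY X.xi p = 0 := by
  rcases N with _ | N
  · exact dY_xi_eq_zero_of_two hy hX
  · exact dY_xi_eq_zero_of_three_le hy hX

theorem dY_dY_eta_eq_zero (hα : N = 0 → α ≠ 3) (hy : ∀ p ∈ U, p.2 ≠ 0)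
    (hX : IsLiePointSymmetry (ode (N + 2) α) X) : ∀ p ∈ U, dY (dY X.eta) p = 0 := by
  have hξ := dY_xi_eq_zero hy hX
  rcases N with _ | _ | N
  · exact dY_dY_eta_eq_zero_of_two (hα rfl) hy hX hξ
  · exact dY_dY_eta_eq_zero_of_three hy hX hξ
  · exact dY_dY_eta_eq_zero_of_four_le hy hX hξ

theorem cast_choose_sub_two (N : ℕ) : ((N + 2).choose N : ℝ) = (N + 2) * (N + 1) / 2 := by
  rw [show (N + 2).choose N = (N + 2).choose 2 from Nat.choose_symm_add, Nat.cast_choose_two]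
  push_cast; ring

theorem cast_choose_sub_three (N : ℕ) :
    ((N + 3).choose N : ℝ) = (N + 3) * (N + 2) * (N + 1) / 6 := by
  have h := Nat.choose_succ_right_eq (N + 3) N
  have h2 := cast_choose_sub_two (N + 1)
  rw [show N + 3 - N = 3 by omega] at h
  have h' : ((N + 3).choose (N + 1) : ℝ) * (N + 1) = (N + 3).choose N * 3 := by exact_mod_cast h
  push_cast at h2
  rw [show N + 1 + 2 = N + 3 by omega] at h2
  rw [h2] at h'
  linear_combination (-1 / 3 : ℝ) * h'

theorem linCoeff_sub_two (X : VField U) (N : ℕ) (p : ℝ × ℝ) : linCoeff X (N + 2) N p =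
    (N + 2) * (dX (dY X.eta) p - (N + 1) / 2 * dX (dX X.xi) p) := by
  have h : (N + 2).choose (N + 1) = N + 2 := Nat.choose_succ_self_right _
  rw [linCoeff, cast_choose_sub_two, h, show N + 2 - 1 - N = 1 by omega,
    show N + 2 - N = 2 by omega]
  simp only [Function.iterate_succ, Function.iterate_zero, Function.comp, id]
  push_cast; ring

theorem linCoeff_sub_three (X : VField U) (N : ℕ) (p : ℝ × ℝ) : linCoeff X (N + 3) N p =
    (N + 3) * (N + 2) / 2 * (dX (dX (dY X.eta)) p - (N + 1) / 3 * dX (dX (dX X.xi)) p) := by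
  have h := cast_choose_sub_two (N + 1)
  rw [show N + 1 + 2 = N + 3 by omega] at h
  rw [linCoeff, cast_choose_sub_three, h, show N + 3 - 1 - N = 2 by omega,
    show N + 3 - N = 3 by omega]
  simp only [Function.iterate_succ, Function.iterate_zero, Function.comp, id]
  push_cast; ring

theorem dX_iterate_eq_zero {f : ℝ × ℝ → ℝ} {m k : ℕ} (hf : ∀ p ∈ U, dX^[m] f p = 0)
    (hk : m ≤ k) : ∀ p ∈ U, dX^[k] f p = 0 := by
  intro p hp
  obtain ⟨l, rfl⟩ := Nat.exists_eq_add_of_le' hk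
  rw [Function.iterate_add_apply, dX_iterate_congr (g := fun _ => 0) hf l p hp, dX_iterate_zero]

/-- A converse of `linear_determining_equations` for fields with `ξ_xxx = 0` and `η_xxy = 0`. -/
theorem isLiePointSymmetry_of_linear (hy : ∀ p ∈ U, p.2 ≠ 0) (hξ : ∀ p ∈ U, dY X.xi p = 0)
    (hη : ∀ p ∈ U, dY (dY X.eta) p = 0) (hξ3 : ∀ p ∈ U, dX^[3] X.xi p = 0)
    (hη2 : ∀ p ∈ U, dX^[2] (dY X.eta) p = 0)
    (h1 : ∀ p ∈ U, dX^[N + 3] X.eta p = 0)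
    (h2 : ∀ p ∈ U, α * dX^[N + 2] X.eta p = 0)
    (h3 : ∀ p ∈ U, p.2 * linCoeff X (N + 3) (N + 1) p + α * dX X.eta p = 0)
    (h4 : ∀ p ∈ U, α * linCoeff X (N + 2) N p = 0)
    (h5 : ∀ p ∈ U, α * (p.2 * dY X.eta p - X.eta p) = 0) :
    IsLiePointSymmetry (ode (N + 2) α) X := by
  rw [isLiePointSymmetry_ode_iff]
  intro x u hu ho
  have hc : ∀ m, etaCoeff X (m + 2) (x, u) = dX^[m + 2] X.eta (x, u 0) +
      (u (m + 1) * linCoeff X (m + 2) m (x, u 0) +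
        u (m + 2) * linCoeff X (m + 2) (m + 1) (x, u 0)) := by
    intro m
    -- Only the two highest derivatives survive: every lower coefficient contains at least two
    -- `x`-derivatives of `η_y` and three of `ξ`.
    rw [etaCoeff_linear hξ hη hu, Finset.sum_range_succ, Finset.sum_range_succ,
      Finset.sum_eq_zero, zero_add]
    intro i hi
    have hi' := Finset.mem_range.1 hi
    rw [linCoeff, dX_iterate_eq_zero hη2 (by omega) _ hu,
      dX_iterate_eq_zero hξ3 (by omega) _ hu]
    ring
  have c1 : etaCoeff X 1 (x, u) = dX X.eta (x, u 0) + u 1 * linCoeff X 1 0 (x, u 0) := by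
    rw [etaCoeff_linear hξ hη hu]; simp
  have e1 := h1 _ hu
  have e2 := h2 _ hu
  have e3 := h3 _ hu
  have e4 := h4 _ hu
  have e5 := h5 _ hu
  have hy' : u 0 ≠ 0 := hy _ hu
  dsimp only at e1 e2 e3 e4 e5
  -- If `α ≠ 0` the first factor vanishes, and if `α = 0` the equation forces `y^(n+1) = 0`.
  -- Multiplying by `y` treats both cases at once.
  have e6 : (u 0 * dY X.eta (x, u 0) - X.eta (x, u 0)) * u (N + 3) = 0 := by
    have : u 0 * ((u 0 * dY X.eta (x, u 0) - X.eta (x, u 0)) * u (N + 3)) = 0 := by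
      linear_combination (u 0 * dY X.eta (x, u 0) - X.eta (x, u 0)) * ho - u 1 * u (N + 2) * e5
    exact (mul_eq_zero.1 this).resolve_left hy'
  have c2 := hc N
  have c3 := hc (N + 1)
  rw [linCoeff_sub_one X (N + 1)] at c2
  rw [linCoeff_sub_one X (N + 1 + 1), show N + 1 + 2 = N + 2 + 1 by omega,
    show N + 1 + 1 = N + 2 by omega] at c3
  rw [show N + 3 = N + 2 + 1 by omega] at e1 e3 e6
  rw [linCoeff_sub_one X 0] at c1
  rw [c1, c2, c3, e1]
  push_cast
  linear_combination u (N + 2) * e3 + u 1 * e2 + u 1 * u (N + 1) * e4 - e6 +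
    (2 * dY X.eta (x, u 0) - (N + 3) * dX X.xi (x, u 0)) * ho

end Linear

open Polynomial

/-! ### Fields that are affine in `y` with polynomial coefficients -/

section AffineField

variable {U : Opens (ℝ × ℝ)}

/-- The vector field `P(x) ∂_x + (Q(x) y + R(x)) ∂_y` on `U`. -/
def affineField (U : Opens (ℝ × ℝ)) (P Q R : ℝ[X]) : VField U :=
  VField.restrict U (fun p => (P.eval p.1, Q.eval p.1 * p.2 + R.eval p.1))
    ((contDiff_polynomial P).prodMk (((contDiff_polynomial Q).mul contDiff_snd).add
      (contDiff_polynomial R))).contDiffOn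

theorem affineField_apply (P Q R : ℝ[X]) {p : ℝ × ℝ} (hp : p ∈ U) :
    (affineField U P Q R).toFun p = (P.eval p.1, Q.eval p.1 * p.2 + R.eval p.1) :=
  VField.restrict_apply hp

theorem xi_affineField (P Q R : ℝ[X]) {p : ℝ × ℝ} (hp : p ∈ U) :
    (affineField U P Q R).xi p = P.eval p.1 := by
  rw [VField.xi, affineField_apply P Q R hp]

theorem eta_affineField (P Q R : ℝ[X]) {p : ℝ × ℝ} (hp : p ∈ U) :
    (affineField U P Q R).eta p = Q.eval p.1 * p.2 + R.eval p.1 := by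
  rw [VField.eta, affineField_apply P Q R hp]

theorem affineField_add (P P' Q Q' R R' : ℝ[X]) :
    affineField U (P + P') (Q + Q') (R + R') = affineField U P Q R + affineField U P' Q' R' :=
  VField.ext fun p hp => by
    rw [VField.toFun_add, Pi.add_apply, affineField_apply _ _ _ hp, affineField_apply _ _ _ hp,
      affineField_apply _ _ _ hp]
    ext <;> simp
    ring

theorem affineField_smul (c : ℝ) (P Q R : ℝ[X]) :
    affineField U (c • P) (c • Q) (c • R) = c • affineField U P Q R :=
  VField.ext fun p hp => by
    rw [VField.toFun_smul, Pi.smul_apply, affineField_apply _ _ _ hp, affineField_apply _ _ _ hp]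
    ext <;> simp
    ring

/-- `affineField` as a linear map. -/
def affineFieldHom (U : Opens (ℝ × ℝ)) : ℝ[X] × ℝ[X] × ℝ[X] →ₗ[ℝ] VField U where
  toFun T := affineField U T.1 T.2.1 T.2.2
  map_add' _ _ := affineField_add _ _ _ _ _ _
  map_smul' _ _ := affineField_smul _ _ _ _

/-- `U` contains a product of neighbourhoods. Two values of `y` separate `Q` from `R`, and a
polynomial vanishing at infinitely many `x` is zero. Thus identities of fields on `U` become
identities of polynomials. -/
theorem affineFieldHom_injective (hU : (U : Set (ℝ × ℝ)).Nonempty) :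
    Function.Injective (affineFieldHom U) := by
  rw [injective_iff_map_eq_zero]
  rintro ⟨P, Q, R⟩ h
  obtain ⟨⟨x₀, y₀⟩, h₀⟩ := hU
  have hnh : (U : Set (ℝ × ℝ)) ∈ nhds (x₀, y₀) := U.isOpen.mem_nhds h₀
  rw [nhds_prod_eq, Filter.mem_prod_iff] at hnh
  obtain ⟨s, hs, t, ht, hst⟩ := hnh
  have hfun : ∀ p ∈ U, P.eval p.1 = 0 ∧ Q.eval p.1 * p.2 + R.eval p.1 = 0 := fun p hp => by
    have := congrArg (fun X : VField U => X.toFun p) h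
    change (affineField U P Q R).toFun p = 0 at this
    rw [affineField_apply _ _ _ hp] at this
    exact ⟨congrArg Prod.fst this, congrArg Prod.snd this⟩
  have hsi : s.Infinite := infinite_of_mem_nhds x₀ hs
  have hti : t.Infinite := infinite_of_mem_nhds y₀ ht
  obtain ⟨y₁, hy₁, hne⟩ : ∃ y₁ ∈ t, y₁ ≠ y₀ := by
    obtain ⟨y₁, h1, h2⟩ := (hti.sdiff (Set.finite_singleton y₀)).nonempty
    exact ⟨y₁, h1, h2⟩
  have hy₀ : y₀ ∈ t := mem_of_mem_nhds ht
  have hzero : ∀ S : ℝ[X], (∀ x ∈ s, S.eval x = 0) → S = 0 := fun S hS =>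
    S.eq_zero_of_infinite_isRoot (hsi.mono fun x hx => hS x hx)
  have hQ : Q = 0 := hzero Q fun x hx => by
    have h1 := (hfun (x, y₀) (hst ⟨hx, hy₀⟩)).2
    have h2 := (hfun (x, y₁) (hst ⟨hx, hy₁⟩)).2
    have : Q.eval x * (y₁ - y₀) = 0 := by
      simp only at h1 h2
      linear_combination h2 - h1
    exact (mul_eq_zero.1 this).resolve_right (sub_ne_zero.2 hne)
  have hP : P = 0 := hzero P fun x hx => (hfun (x, y₀) (hst ⟨hx, hy₀⟩)).1
  have hR : R = 0 := hzero R fun x hx => by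
    simpa [hQ] using (hfun (x, y₀) (hst ⟨hx, hy₀⟩)).2
  simp [hP, hQ, hR]

theorem fderiv_affineField (P Q R : ℝ[X]) {p : ℝ × ℝ} (hp : p ∈ U) (w : ℝ × ℝ) :
    fderiv ℝ (affineField U P Q R).toFun p w = (P.derivative.eval p.1 * w.1,
      (Q.derivative.eval p.1 * p.2 + R.derivative.eval p.1) * w.1 + Q.eval p.1 * w.2) := by
  have h : ∀ S : ℝ[X], HasFDerivAt (fun p : ℝ × ℝ => S.eval p.1) _ p := fun S =>
    (S.hasDerivAt p.1).comp_hasFDerivAt p (hasFDerivAt_fst (𝕜 := ℝ) (p := p))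
  have hq : (affineField U P Q R).toFun =ᶠ[nhds p]
      fun p => (P.eval p.1, Q.eval p.1 * p.2 + R.eval p.1) :=
    Filter.eventuallyEq_of_mem (U.isOpen.mem_nhds hp) fun q hq => affineField_apply P Q R hq
  rw [hq.fderiv_eq, ((h P).prodMk (((h Q).fun_mul (hasFDerivAt_snd (𝕜 := ℝ) (p := p))).fun_add (h R))).fderiv]
  ext <;> simp
  ring

/-- This bracket formula reduces every homomorphism property below to polynomial algebra. -/
theorem lie_affineField (P P' Q Q' R R' : ℝ[X]) :
    ⁅affineField U P Q R, affineField U P' Q' R'⁆ = affineField U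
      (P * derivative P' - P' * derivative P) (P * derivative Q' - P' * derivative Q)
      (P * derivative R' + R * Q' - (P' * derivative R + R' * Q)) :=
  VField.ext fun p hp => by
    rw [VField.lie_apply _ _ hp, affineField_apply _ _ _ hp, VectorField.lieBracket,
      fderiv_affineField _ _ _ hp, fderiv_affineField _ _ _ hp, affineField_apply _ _ _ hp,
      affineField_apply _ _ _ hp]
    ext <;> simp <;> ring

theorem dX_iterate_affine (Q R : ℝ[X]) (k : ℕ) :
    dX^[k] (fun p => Q.eval p.1 * p.2 + R.eval p.1) =
      fun p => (derivative^[k] Q).eval p.1 * p.2 + (derivative^[k] R).eval p.1 := by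
  induction k generalizing Q R with
  | zero => rfl
  | succ k ih =>
    rw [Function.iterate_succ_apply, Function.iterate_succ_apply, Function.iterate_succ_apply,
      ← ih]
    congr 1
    funext p
    have hd : ∀ S : ℝ[X], DifferentiableAt ℝ (fun p : ℝ × ℝ => S.eval p.1) p := fun S =>
      (contDiff_polynomial S).differentiable (by simp) p
    have hs : DifferentiableAt ℝ (fun p : ℝ × ℝ => p.2) p := differentiableAt_snd
    rw [dX_add ((hd Q).fun_mul hs) (hd R), dX_mul (hd Q) hs, dX_polynomial, dX_polynomial]
    have : dX (fun p : ℝ × ℝ => p.2) p = 0 := congrFun dX_snd p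
    rw [this]; ring

theorem dY_affine (Q R : ℝ[X]) :
    dY (fun p => Q.eval p.1 * p.2 + R.eval p.1) = fun p => Q.eval p.1 := by
  funext p
  have hd : ∀ S : ℝ[X], DifferentiableAt ℝ (fun p : ℝ × ℝ => S.eval p.1) p := fun S =>
    (contDiff_polynomial S).differentiable (by simp) p
  have hs : DifferentiableAt ℝ (fun p : ℝ × ℝ => p.2) p := differentiableAt_snd
  rw [dY_add ((hd Q).fun_mul hs) (hd R), dY_mul (hd Q) hs, dY_polynomial, dY_polynomial]
  have : dY (fun p : ℝ × ℝ => p.2) p = 1 := congrFun dY_snd p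
  rw [this]; ring

end AffineField

/-! ### Classification of the symmetries -/

section Classification

variable {U : Opens (ℝ × ℝ)} {X : VField U} {α : ℝ} {N : ℕ}

theorem dX_const_mul {f : ℝ × ℝ → ℝ} {p : ℝ × ℝ} (c : ℝ) (hf : DifferentiableAt ℝ f p) :
    dX (fun q => c * f q) p = c * dX f p := by
  rw [dX_mul (differentiableAt_const c) hf, dX_const]; ring

theorem dX_sub_snd_mul {f g : ℝ × ℝ → ℝ} (hf : ContDiffOn ℝ ∞ f U) (hg : ContDiffOn ℝ ∞ g U)
    {p : ℝ × ℝ} (hp : p ∈ U) :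
    dX (fun q => f q + -1 * (q.2 * g q)) p = dX f p + -1 * (p.2 * dX g p) := by
  have df := differentiableAt_of_contDiffOn hf hp
  have dg := differentiableAt_of_contDiffOn hg hp
  have ds : DifferentiableAt ℝ (fun p : ℝ × ℝ => p.2) p := differentiableAt_snd
  have : dX (fun p : ℝ × ℝ => p.2) p = 0 := congrFun dX_snd p
  rw [dX_add df ((differentiableAt_const _).fun_mul (ds.fun_mul dg)),
    dX_const_mul _ (ds.fun_mul dg), dX_mul ds dg, this]
  ring

theorem dX_iterate_sub_snd_mul {f g : ℝ × ℝ → ℝ} (hf : ContDiffOn ℝ ∞ f U)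
    (hg : ContDiffOn ℝ ∞ g U) (k : ℕ) : ∀ p ∈ U,
    dX^[k] (fun q => f q + -1 * (q.2 * g q)) p = dX^[k] f p + -1 * (p.2 * dX^[k] g p) := by
  induction k generalizing f g with
  | zero => exact fun p _ => rfl
  | succ k ih =>
    intro p hp
    rw [Function.iterate_succ_apply, Function.iterate_succ_apply, Function.iterate_succ_apply,
      dX_iterate_congr (fun q hq => dX_sub_snd_mul hf hg hq) k p hp,
      ih (contDiffOn_dX hf) (contDiffOn_dX hg) p hp]

/-- Three functions satisfy the hypotheses of `exists_polynomial`: `ξ`, `η_y - m ξ_x` (with one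
`x`-derivative, hence constant) and `η - y η_y`. Together they recover the field. The case `M = 0`
encodes `R = 0`. -/
theorem exists_eq_affineField (hU : IsPreconnected (U : Set (ℝ × ℝ))) {d M : ℕ} {m : ℝ}
    (hξ : ∀ p ∈ U, dY X.xi p = 0) (hη : ∀ p ∈ U, dY (dY X.eta) p = 0)
    (hd : ∀ p ∈ U, dX^[d] X.xi p = 0)
    (hm : ∀ p ∈ U, dX (dY X.eta) p = m * dX (dX X.xi) p)
    (hM : ∀ p ∈ U, dX^[M] X.eta p + -1 * (p.2 * dX^[M] (dY X.eta) p) = 0) :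
    ∃ (P R : ℝ[X]) (c : ℝ), P.degree < d ∧ R.degree < M ∧
      X = affineField U P (C m * derivative P + C c) R := by
  have sξ := contDiffOn_xi X
  have sη := contDiffOn_eta X
  have sa := contDiffOn_dY sη
  obtain ⟨P, hPd, hP⟩ := exists_polynomial hU d X.xi sξ hξ hd
  have hξx : ∀ p ∈ U, dX X.xi p = P.derivative.eval p.1 := fun p hp => by
    rw [dX_congr hP hp, dX_polynomial]
  obtain ⟨A, hAd, hA⟩ := exists_polynomial hU 1 (fun q => dY X.eta q + -m * dX X.xi q)
    (sa.add (contDiffOn_const.mul (contDiffOn_dX sξ)))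
    (fun p hp => by
      have d1 := differentiableAt_of_contDiffOn sa hp
      have d2 := differentiableAt_of_contDiffOn (contDiffOn_dX sξ) hp
      rw [dY_add d1 ((differentiableAt_const _).fun_mul d2),
        dY_mul (differentiableAt_const _) d2, dY_const, hη p hp, dY_dX_eq_zero sξ hξ p hp]
      ring)
    (fun p hp => by
      have d1 := differentiableAt_of_contDiffOn sa hp
      have d2 := differentiableAt_of_contDiffOn (contDiffOn_dX sξ) hp
      rw [Function.iterate_one, dX_add d1 ((differentiableAt_const _).fun_mul d2),
        dX_const_mul _ d2, hm p hp]
      ring)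
  obtain ⟨c, rfl⟩ : ∃ c, A = C c := by
    by_cases hA0 : A = 0
    · exact ⟨0, by simp [hA0]⟩
    · exact ⟨_, eq_C_of_natDegree_eq_zero
        (Nat.lt_one_iff.1 ((natDegree_lt_iff_degree_lt hA0).2 hAd))⟩
  obtain ⟨R, hRd, hR⟩ := exists_polynomial hU M (fun q => X.eta q + -1 * (q.2 * dY X.eta q))
    (sη.add (contDiffOn_const.mul (contDiffOn_snd.mul sa)))
    (fun p hp => by
      have d0 := differentiableAt_of_contDiffOn sη hp
      have d1 := differentiableAt_of_contDiffOn sa hp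
      have ds : DifferentiableAt ℝ (fun p : ℝ × ℝ => p.2) p := differentiableAt_snd
      have h1 : dY (fun p : ℝ × ℝ => p.2) p = 1 := congrFun dY_snd p
      rw [dY_add d0 ((differentiableAt_const _).fun_mul (ds.fun_mul d1)),
        dY_mul (differentiableAt_const _) (ds.fun_mul d1), dY_const, dY_mul ds d1, h1, hη p hp]
      ring)
    (fun p hp => by rw [dX_iterate_sub_snd_mul sη sa M p hp]; exact hM p hp)
  refine ⟨P, R, c, hPd, hRd, VField.ext fun p hp => ?_⟩
  rw [affineField_apply _ _ _ hp]
  refine Prod.ext (hP p hp) ?_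
  change X.eta p = _
  have h1 := hA p hp
  have h2 := hR p hp
  simp only [eval_C, eval_add, eval_mul] at h1 h2 ⊢
  rw [← hξx p hp]
  linear_combination h2 + p.2 * h1

/-- The conditions `h1` and `h2` are the coefficients of `y^(n)` and `y' y^(n-1)`. If `P'' ≠ 0`,
they hold for `α = 0` with `m = n/2`, and for `α ≠ 0` exactly when `m = (n-1)/2` and `α =
(n+1)/(n-1)`. -/
theorem isLiePointSymmetry_affineField (hy : ∀ p ∈ U, p.2 ≠ 0) {P R : ℝ[X]} {m c : ℝ}
    (hP : derivative (derivative (derivative P)) = 0) (hR : derivative^[N + 3] R = 0)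
    (hαR : α = 0 ∨ R = 0)
    (h1 : ∀ x, ((N + 3) * (m - (N + 2) / 2) + α * m) * (derivative (derivative P)).eval x = 0)
    (h2 : ∀ x, α * (m - (N + 1) / 2) * (derivative (derivative P)).eval x = 0) :
    IsLiePointSymmetry (ode (N + 2) α) (affineField U P (C m * derivative P + C c) R) := by
  set Q : ℝ[X] := C m * derivative P + C c with hQ
  have hQ1 : derivative Q = C m * derivative (derivative P) := by simp [hQ]
  have hQ2 : derivative^[2] Q = 0 := by
    simp [hQ1, hP]
  have hxi : ∀ p ∈ U, (affineField U P Q R).xi p = P.eval p.1 := fun p hp =>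
    xi_affineField P Q R hp
  have heta : ∀ p ∈ U, (affineField U P Q R).eta p = Q.eval p.1 * p.2 + R.eval p.1 := fun p hp =>
    eta_affineField P Q R hp
  have hdxi : ∀ k, ∀ p ∈ U, dX^[k] (affineField U P Q R).xi p = (derivative^[k] P).eval p.1 :=
    fun k p hp => by rw [dX_iterate_congr hxi k p hp, dX_iterate_polynomial]
  have hdeta : ∀ k, ∀ p ∈ U, dX^[k] (affineField U P Q R).eta p =
      (derivative^[k] Q).eval p.1 * p.2 + (derivative^[k] R).eval p.1 :=
    fun k p hp => by rw [dX_iterate_congr heta k p hp, dX_iterate_affine]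
  have hya : ∀ p ∈ U, dY (affineField U P Q R).eta p = Q.eval p.1 := fun p hp => by
    rw [dY_congr heta hp, dY_affine]
  have hdya : ∀ k, ∀ p ∈ U, dX^[k] (dY (affineField U P Q R).eta) p =
      (derivative^[k] Q).eval p.1 :=
    fun k p hp => by rw [dX_iterate_congr hya k p hp, dX_iterate_polynomial]
  have hxi2 : ∀ p ∈ U, dX (dX (affineField U P Q R).xi) p =
      (derivative (derivative P)).eval p.1 := hdxi 2
  have hax : ∀ p ∈ U, dX (dY (affineField U P Q R).eta) p =
      m * (derivative (derivative P)).eval p.1 := fun p hp => by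
    rw [← Function.iterate_one dX, hdya 1 p hp]; simp [hQ1]
  have hQk : ∀ k, derivative^[k + 2] Q = 0 := fun k => by
    rw [Function.iterate_add_apply, hQ2]; simp
  refine isLiePointSymmetry_of_linear hy ?_ ?_ ?_ ?_ ?_ ?_ ?_ ?_ ?_
  · intro p hp
    rw [dY_congr hxi hp, dY_polynomial]
  · intro p hp
    rw [dY_congr hya hp, dY_polynomial]
  · intro p hp
    rw [hdxi 3 p hp]; simp [hP]
  · intro p hp
    rw [hdya 2 p hp, hQ2]; simp
  · intro p hp
    rw [hdeta _ p hp, hR, hQk (N + 1)]; simp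
  · intro p hp
    rw [hdeta _ p hp, hQk N]
    rcases hαR with h | h <;> simp [h]
  · intro p hp
    have h := hdeta 1 p hp
    rw [Function.iterate_one] at h
    rw [linCoeff_sub_two _ (N + 1), hax p hp, hxi2 p hp, h]
    simp only [Function.iterate_one, hQ1, eval_mul, eval_C]
    have hr : α * (derivative R).eval p.1 = 0 := by rcases hαR with h | h <;> simp [h]
    push_cast
    linear_combination p.2 * h1 p.1 + hr
  · intro p hp
    rw [linCoeff_sub_two, hax p hp, hxi2 p hp]
    linear_combination (N + 2 : ℝ) * h2 p.1
  · intro p hp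
    rw [hya p hp, heta p hp]
    have hr : α * R.eval p.1 = 0 := by rcases hαR with h | h <;> simp [h]
    linear_combination -hr

theorem iterate_derivative_eq_zero_of_degree_lt {P : ℝ[X]} {d : ℕ} (h : P.degree < d) :
    derivative^[d] P = 0 := by
  by_cases h0 : P = 0
  · simp [h0]
  · exact iterate_derivative_eq_zero ((natDegree_lt_iff_degree_lt h0).2 h)

theorem isLiePointSymmetry_ode_zero_iff (hU : IsPreconnected (U : Set (ℝ × ℝ)))
    (hy : ∀ p ∈ U, p.2 ≠ 0) : IsLiePointSymmetry (ode (N + 2) 0) X ↔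
      ∃ (P R : ℝ[X]) (c : ℝ), P.degree < (3 : ℕ) ∧ R.degree < (N + 3 : ℕ) ∧
        X = affineField U P (C (((N : ℝ) + 2) / 2) * derivative P + C c) R := by
  constructor
  · intro hX
    have hξ := dY_xi_eq_zero hy hX
    have hη := dY_dY_eta_eq_zero (fun _ => by norm_num) hy hX
    have hdet := linear_determining_equations hy hX hξ hη
    have sξ := contDiffOn_xi X
    have hm : ∀ p ∈ U, dX (dY X.eta) p = ((N : ℝ) + 2) / 2 * dX (dX X.xi) p := fun p hp => by
      have h := (hdet p hp).2.1
      rw [linCoeff_sub_two X (N + 1)] at h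
      push_cast at h
      have hne : p.2 * ((N : ℝ) + 3) ≠ 0 := mul_ne_zero (hy p hp) (by positivity)
      have : p.2 * ((N : ℝ) + 3) *
          (dX (dY X.eta) p - ((N : ℝ) + 2) / 2 * dX (dX X.xi) p) = 0 := by
        linear_combination h
      linarith [(mul_eq_zero.1 this).resolve_left hne]
    have hmx : ∀ p ∈ U, dX (dX (dY X.eta)) p = ((N : ℝ) + 2) / 2 * dX (dX (dX X.xi)) p :=
      fun p hp => by
      rw [dX_congr hm hp, dX_const_mul _
        (differentiableAt_of_contDiffOn (contDiffOn_dX (contDiffOn_dX sξ)) hp)]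
    -- `η_xxy` equals both `(n/2) ξ_xxx` and `((n-1)/3) ξ_xxx`; the factors differ by `(n+2)/6 > 0`.
    have h3 : ∀ p ∈ U, dX^[3] X.xi p = 0 := fun p hp => by
      have h := (hdet p hp).2.2.1 (Or.inr rfl)
      rw [linCoeff_sub_three, hmx p hp] at h
      have hne : ((N : ℝ) + 3) * (N + 2) / 2 * ((N + 4) / 6) ≠ 0 := by positivity
      have : ((N : ℝ) + 3) * (N + 2) / 2 * ((N + 4) / 6) * dX (dX (dX X.xi)) p = 0 := by
        linear_combination h
      exact (mul_eq_zero.1 this).resolve_left hne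
    have ha2 : ∀ p ∈ U, dX^[2] (dY X.eta) p = 0 := fun p hp => by
      have := h3 p hp
      simp only [Function.iterate_succ, Function.iterate_zero, Function.comp, id] at this ⊢
      rw [hmx p hp, this, mul_zero]
    exact exists_eq_affineField hU hξ hη h3 hm fun p hp => by
      rw [(hdet p hp).1, dX_iterate_eq_zero ha2 (by omega) p hp]; ring
  · rintro ⟨P, R, c, hP, hR, rfl⟩
    exact isLiePointSymmetry_affineField hy (iterate_derivative_eq_zero_of_degree_lt hP)
      (iterate_derivative_eq_zero_of_degree_lt hR) (Or.inl rfl) (fun x => by ring)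
      (fun x => by ring)

/-- For `α ≠ 0`, a symmetry has `η = y η_y`, `η_xy = (n-1)/2 ξ_xx`, and `ξ_xx = 0` unless
`α = (n+1)/(n-1)`. -/
theorem determining_equations_of_ne_zero (h0 : α ≠ 0) (hy : ∀ p ∈ U, p.2 ≠ 0)
    (hα : N = 0 → α ≠ 3) (hX : IsLiePointSymmetry (ode (N + 2) α) X) : ∀ p ∈ U,
    X.eta p + -1 * (p.2 * dY X.eta p) = 0 ∧
    dX (dY X.eta) p = ((N : ℝ) + 1) / 2 * dX (dX X.xi) p ∧
    (α * (N + 1) - (N + 3)) * dX (dX X.xi) p = 0 := by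
  have hξ := dY_xi_eq_zero hy hX
  have hη := dY_dY_eta_eq_zero hα hy hX
  have hdet := linear_determining_equations hy hX hξ hη
  have sη := contDiffOn_eta X
  have hb : ∀ p ∈ U, X.eta p + -1 * (p.2 * dY X.eta p) = 0 := fun p hp => by
    have := (mul_eq_zero.1 (hdet p hp).2.2.2.2).resolve_left h0
    linear_combination -this
  intro p hp
  -- The `x`-derivative of `η = y η_y` turns the term `α η_x` of the `y^(n)` equation into `α y
  -- η_xy`, which makes it an equation for `ξ_xx` alone.
  have hbx : dX X.eta p + -1 * (p.2 * dX (dY X.eta) p) = 0 := by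
    rw [← dX_sub_snd_mul sη (contDiffOn_dY sη) hp]
    exact dX_eq_zero hb hp
  have ha : dX (dY X.eta) p = ((N : ℝ) + 1) / 2 * dX (dX X.xi) p := by
    have h := (mul_eq_zero.1 (hdet p hp).2.2.2.1).resolve_left h0
    rw [linCoeff_sub_two] at h
    have hne : (N : ℝ) + 2 ≠ 0 := by positivity
    linarith [(mul_eq_zero.1 h).resolve_left hne]
  refine ⟨hb p hp, ha, ?_⟩
  have h := (hdet p hp).2.1
  rw [linCoeff_sub_two X (N + 1)] at h
  push_cast at h
  have : p.2 * ((α * (N + 1) - (N + 3)) * dX (dX X.xi) p) = 0 := by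
    linear_combination 2 * h - 2 * α * hbx - 2 * p.2 * (N + 3 + α) * ha
  exact (mul_eq_zero.1 this).resolve_left (hy p hp)

theorem isLiePointSymmetry_ode_special_iff (hU : IsPreconnected (U : Set (ℝ × ℝ)))
    (hy : ∀ p ∈ U, p.2 ≠ 0) (hN : 1 ≤ N) (hα : α * (N + 1) = N + 3) :
    IsLiePointSymmetry (ode (N + 2) α) X ↔
      ∃ (P : ℝ[X]) (c : ℝ), P.degree < (3 : ℕ) ∧
        X = affineField U P (C (((N : ℝ) + 1) / 2) * derivative P + C c) 0 := by
  have h0 : α ≠ 0 := by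
    rintro rfl
    have : (0 : ℝ) < N + 3 := by positivity
    linarith
  constructor
  · intro hX
    have hα3 : N = 0 → α ≠ 3 := fun h => by omega
    have hξ := dY_xi_eq_zero hy hX
    have hη := dY_dY_eta_eq_zero hα3 hy hX
    have hdet := determining_equations_of_ne_zero h0 hy hα3 hX
    have hm : ∀ p ∈ U, dX (dY X.eta) p = ((N : ℝ) + 1) / 2 * dX (dX X.xi) p := fun p hp =>
      (hdet p hp).2.1
    -- The same comparison, now between `(n-1)/2` and `(n-1)/3`; this is where `n ≥ 3` is needed.
    have h3 : ∀ p ∈ U, dX^[3] X.xi p = 0 := fun p hp => by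
      have h := (linear_determining_equations hy hX hξ hη p hp).2.2.1 (Or.inl hN)
      rw [linCoeff_sub_three, dX_congr hm hp, dX_const_mul _ (differentiableAt_of_contDiffOn
        (contDiffOn_dX (contDiffOn_dX (contDiffOn_xi X))) hp)] at h
      have hne : ((N : ℝ) + 3) * (N + 2) / 2 * ((N + 1) / 6) ≠ 0 := by positivity
      have : ((N : ℝ) + 3) * (N + 2) / 2 * ((N + 1) / 6) * dX (dX (dX X.xi)) p = 0 := by
        linear_combination h
      exact (mul_eq_zero.1 this).resolve_left hne
    obtain ⟨P, R, c, hP, hR, hXe⟩ := exists_eq_affineField (M := 0) hU hξ hη h3 hm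
      fun p hp => (hdet p hp).1
    have hR0 : R = 0 := by simpa using hR
    exact ⟨P, c, hP, by rw [hXe, hR0]⟩
  · rintro ⟨P, c, hP, rfl⟩
    exact isLiePointSymmetry_affineField hy (iterate_derivative_eq_zero_of_degree_lt hP)
      (by simp) (Or.inr rfl)
      (fun x => by linear_combination ((derivative (derivative P)).eval x / 2) * hα)
      (fun x => by ring)

theorem isLiePointSymmetry_ode_generic_iff (hU : IsPreconnected (U : Set (ℝ × ℝ)))
    (hy : ∀ p ∈ U, p.2 ≠ 0) (h0 : α ≠ 0) (hα : α * (N + 1) ≠ N + 3) :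
    IsLiePointSymmetry (ode (N + 2) α) X ↔
      ∃ (P : ℝ[X]) (c : ℝ), P.degree < (2 : ℕ) ∧ X = affineField U P (C c) 0 := by
  constructor
  · intro hX
    have hα3 : N = 0 → α ≠ 3 := by
      rintro rfl rfl
      norm_num at hα
    have hξ := dY_xi_eq_zero hy hX
    have hη := dY_dY_eta_eq_zero hα3 hy hX
    have hdet := determining_equations_of_ne_zero h0 hy hα3 hX
    have h2 : ∀ p ∈ U, dX (dX X.xi) p = 0 := fun p hp =>
      (mul_eq_zero.1 (hdet p hp).2.2).resolve_left (sub_ne_zero.2 hα)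
    -- With `ξ_xx = 0` the weight `m` is arbitrary, and `m = 0` gives the basis field `x ∂_x`
    -- without a `y ∂_y` part.
    obtain ⟨P, R, c, hP, hR, hXe⟩ := exists_eq_affineField (M := 0) (d := 2) (m := 0) hU hξ hη h2
      (fun p hp => by rw [(hdet p hp).2.1, h2 p hp]; ring) fun p hp => (hdet p hp).1
    have hR0 : R = 0 := by simpa using hR
    exact ⟨P, c, hP, by rw [hXe, hR0]; simp⟩
  · rintro ⟨P, c, hP, rfl⟩
    have h2 : derivative (derivative P) = 0 := iterate_derivative_eq_zero_of_degree_lt hP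
    have := isLiePointSymmetry_affineField (α := α) (N := N) (m := 0) (c := c) (P := P) (R := 0) hy
      (by simp [h2]) (by simp) (Or.inr rfl) (by simp [h2]) (by simp [h2])
    simpa using this

end Classification

/-! ### Realisations of the abstract Lie algebras by vector fields -/

section Realisation

variable {U : Opens (ℝ × ℝ)}

/-- The quadratic polynomial `a + b x + c x ^ 2`. -/
def quadPoly (a b c : ℝ) : ℝ[X] := C c * X ^ 2 + C b * X + C a

theorem quadPoly_degree_lt (a b c : ℝ) : (quadPoly a b c).degree < (3 : ℕ) :=
  degree_quadratic_lt

theorem derivative_quadPoly (a b c : ℝ) : derivative (quadPoly a b c) = C (2 * c) * X + C b := by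
  simp only [quadPoly, derivative_add, derivative_C_mul_X_pow, derivative_C_mul_X, derivative_C,
    Nat.add_one_sub_one, pow_one, add_zero, Nat.cast_ofNat]
  rw [mul_comm c 2]

theorem quadPoly_eq_zero_iff {a b c : ℝ} : quadPoly a b c = 0 ↔ a = 0 ∧ b = 0 ∧ c = 0 := by
  constructor
  · intro h
    have h0 := congrArg (fun P : ℝ[X] => P.coeff 0) h
    have h1 := congrArg (fun P : ℝ[X] => P.coeff 1) h
    have h2 := congrArg (fun P : ℝ[X] => P.coeff 2) h
    simp [quadPoly, coeff_X, coeff_C, coeff_X_pow] at h0 h1 h2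
    exact ⟨h0, h1, h2⟩
  · rintro ⟨rfl, rfl, rfl⟩
    simp [quadPoly]

theorem exists_quadPoly {P : ℝ[X]} (h : P.degree < (3 : ℕ)) : ∃ a b c, P = quadPoly a b c := by
  refine ⟨P.coeff 0, P.coeff 1, P.coeff 2, ?_⟩
  by_cases h0 : P = 0
  · simp [h0, quadPoly]
  · conv_lhs => rw [P.as_sum_range_C_mul_X_pow' ((natDegree_lt_iff_degree_lt h0).2 h)]
    simp [Finset.sum_range_succ, quadPoly]
    ring

theorem exists_linPoly {P : ℝ[X]} (h : P.degree < (2 : ℕ)) : ∃ a b, P = C b * X + C a := by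
  refine ⟨P.coeff 0, P.coeff 1, ?_⟩
  by_cases h0 : P = 0
  · simp [h0]
  · conv_lhs => rw [P.as_sum_range_C_mul_X_pow' ((natDegree_lt_iff_degree_lt h0).2 h)]
    simp [Finset.sum_range_succ]
    ring

theorem Sl2.apply_one_one (s : Sl2) : s.1 1 1 = -s.1 0 0 := by
  have h : Matrix.trace (s.1 : Matrix (Fin 2) (Fin 2) ℝ) = 0 := s.2
  have h' : s.1 0 0 + s.1 1 1 = 0 := (Matrix.trace_fin_two _).symm.trans h
  linarith

/-- The trace-free matrix with entries `a, b, c, -a`. -/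
def Sl2.of (a b c : ℝ) : Sl2 := ⟨!![a, b; c, -a], by
  change Matrix.trace (!![a, b; c, -a] : Matrix (Fin 2) (Fin 2) ℝ) = 0
  simp [Matrix.trace_fin_two]⟩

/-- The coefficient of `∂_x` of the projective vector field of a trace-free matrix. -/
def sl2Poly : Sl2 →ₗ[ℝ] ℝ[X] where
  toFun s := quadPoly (s.1 0 1) (-2 * s.1 0 0) (-s.1 1 0)
  map_add' s t := by
    simp [quadPoly]; ring
  map_smul' c s := by
    simp [quadPoly, smul_eq_C_mul]; ring

theorem sl2Poly_apply (s : Sl2) : sl2Poly s = quadPoly (s.1 0 1) (-2 * s.1 0 0) (-s.1 1 0) := rfl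

/-- The sign of the linear term in `sl2Poly` matters: with `2a x` in place of `-2a x` the bracket
would be reversed. -/
theorem sl2Poly_lie (s t : Sl2) : sl2Poly ⁅s, t⁆ =
    sl2Poly s * derivative (sl2Poly t) - sl2Poly t * derivative (sl2Poly s) := by
  have hb : (⁅s, t⁆ : Sl2).1 = s.1 * t.1 - t.1 * s.1 := rfl
  rw [sl2Poly_apply, sl2Poly_apply, sl2Poly_apply, hb, derivative_quadPoly, derivative_quadPoly]
  simp only [Matrix.sub_apply, Matrix.mul_apply, Fin.sum_univ_two, Sl2.apply_one_one, quadPoly,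
    C_sub, C_add, C_mul, C_neg]
  simp only [show (C 2 : ℝ[X]) = 2 from rfl]
  ring

theorem sl2Poly_injective : Function.Injective sl2Poly := by
  rw [injective_iff_map_eq_zero]
  intro s hs
  rw [sl2Poly_apply, quadPoly_eq_zero_iff] at hs
  obtain ⟨h1, h2, h3⟩ := hs
  have h11 := Sl2.apply_one_one s
  refine Subtype.ext (Matrix.ext fun i j => ?_)
  fin_cases i <;> fin_cases j <;> simp_all

theorem sl2Poly_of (a b c : ℝ) : sl2Poly (Sl2.of (-b / 2) a (-c)) = quadPoly a b c := by
  rw [sl2Poly_apply]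
  simp only [Sl2.of, Matrix.of_apply, Matrix.cons_val', Matrix.cons_val_zero, Matrix.cons_val_one,
    Matrix.cons_val_fin_one, neg_neg]
  congr 1
  ring

/-- The coordinate of `A₁`. -/
def A1.coord : A1 →ₗ[ℝ] ℝ where
  toFun t := t 0
  map_add' _ _ := rfl
  map_smul' _ _ := rfl

theorem A1.coord_lie (s t : A1) : A1.coord ⁅s, t⁆ = 0 := rfl

theorem A1.coord_injective : Function.Injective A1.coord := fun s t h =>
  funext fun i => by rw [Subsingleton.elim i 0]; exact h

/-- The element of `A₁` with coordinate `c`. -/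
def A1.of (c : ℝ) : A1 := fun _ => c

theorem A1.coord_of (c : ℝ) : A1.coord (A1.of c) = c := rfl

theorem A1.coord_unit : A1.coord (AbelianLie.unit 0) = 1 :=
  Pi.single_eq_same (M := fun _ : Fin 1 => ℝ) 0 1

/-- The coefficient of `y ∂_y` of the field that represents an element of `A₁ ⊕ sl(2, ℝ)`. -/
def weightPoly (m : ℝ) : A1 × Sl2 →ₗ[ℝ] ℝ[X] where
  toFun x := C m * derivative (sl2Poly x.2) + C (A1.coord x.1)
  map_add' x y := by simp; ring
  map_smul' c x := by simp [smul_eq_C_mul]; ring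

theorem weightPoly_apply (m : ℝ) (x : A1 × Sl2) :
    weightPoly m x = C m * derivative (sl2Poly x.2) + C (A1.coord x.1) := rfl

/-- This holds for every weight `m`, because `(P S' - S P')' = P S'' - S P''` and the constant part
is killed by differentiation. -/
theorem weightPoly_lie (m : ℝ) (x y : A1 × Sl2) : weightPoly m ⁅x, y⁆ =
    sl2Poly x.2 * derivative (weightPoly m y) - sl2Poly y.2 * derivative (weightPoly m x) := by
  have h1 : (⁅x, y⁆ : A1 × Sl2).1 = ⁅x.1, y.1⁆ := rfl
  have h2 : (⁅x, y⁆ : A1 × Sl2).2 = ⁅x.2, y.2⁆ := rfl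
  rw [weightPoly_apply, weightPoly_apply, weightPoly_apply, h1, h2, A1.coord_lie, sl2Poly_lie]
  simp only [derivative_sub, derivative_mul, derivative_add, derivative_C]
  simp
  ring

/-- The realisation of `A₁ ⊕ sl(2, ℝ)` by the fields `P ∂_x + (m P' + c) y ∂_y`. -/
def sl2Field (U : Opens (ℝ × ℝ)) (m : ℝ) : A1 × Sl2 →ₗ⁅ℝ⁆ VField U where
  toLinearMap := affineFieldHom U ∘ₗ
    ((sl2Poly ∘ₗ LinearMap.snd ℝ A1 Sl2).prod ((weightPoly m).prod 0))
  map_lie' := by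
    intro x y
    change affineField U (sl2Poly ⁅x.2, y.2⁆) (weightPoly m ⁅x, y⁆) 0 =
      ⁅affineField U (sl2Poly x.2) (weightPoly m x) 0,
        affineField U (sl2Poly y.2) (weightPoly m y) 0⁆
    rw [lie_affineField, sl2Poly_lie, weightPoly_lie]
    simp

theorem sl2Field_apply (m : ℝ) (x : A1 × Sl2) :
    sl2Field U m x = affineField U (sl2Poly x.2) (weightPoly m x) 0 := rfl

theorem sl2Field_injective (hU : (U : Set (ℝ × ℝ)).Nonempty) (m : ℝ) :
    Function.Injective (sl2Field U m) := by
  rw [injective_iff_map_eq_zero]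
  intro x hx
  have h : ((sl2Poly x.2, weightPoly m x, 0) : ℝ[X] × ℝ[X] × ℝ[X]) = 0 :=
    affineFieldHom_injective hU (hx.trans (map_zero _).symm)
  simp only [Prod.mk_eq_zero, weightPoly_apply] at h
  obtain ⟨h1, h2, -⟩ := h
  rw [h1] at h2
  have h3 : A1.coord x.1 = 0 := by simpa using h2
  exact Prod.ext (A1.coord_injective (h3.trans (map_zero _).symm))
    (sl2Poly_injective (h1.trans (map_zero _).symm))

theorem mem_range_sl2Field_iff (m : ℝ) (X : VField U) : X ∈ (sl2Field U m).range ↔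
    ∃ (P : ℝ[X]) (c : ℝ), P.degree < (3 : ℕ) ∧
      X = affineField U P (C m * derivative P + C c) 0 := by
  rw [LieHom.mem_range]
  constructor
  · rintro ⟨x, rfl⟩
    exact ⟨sl2Poly x.2, A1.coord x.1, quadPoly_degree_lt _ _ _, rfl⟩
  · rintro ⟨P, c, hP, rfl⟩
    obtain ⟨a, b, d, rfl⟩ := exists_quadPoly hP
    exact ⟨(A1.of c, Sl2.of (-b / 2) a (-d)), by
      rw [sl2Field_apply, weightPoly_apply, sl2Poly_of, A1.coord_of]⟩

/-- The realisation of `A₂ ⊕ A₁` by the fields `(a + b x) ∂_x + c y ∂_y`. -/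
def scalingField (U : Opens (ℝ × ℝ)) : A2 × A1 →ₗ⁅ℝ⁆ VField U where
  toFun x := affineField U (C x.1.2 * X + C x.1.1) (C (A1.coord x.2)) 0
  map_add' x y := by
    have h1 : (x + y).1.1 = x.1.1 + y.1.1 := rfl
    have h2 : (x + y).1.2 = x.1.2 + y.1.2 := rfl
    rw [← affineField_add, h1, h2, Prod.snd_add, map_add A1.coord, C_add, C_add, C_add, add_zero]
    congr 1
    ring
  map_smul' c x := by
    have h1 : (c • x).1.1 = c * x.1.1 := rfl
    have h2 : (c • x).1.2 = c * x.1.2 := rfl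
    rw [RingHom.id_apply, ← affineField_smul, h1, h2, Prod.smul_snd, map_smul]
    simp only [smul_eq_C_mul, smul_eq_mul, C_mul, mul_zero]
    congr 1
    ring
  map_lie' := by
    intro x y
    have h1 : (⁅x, y⁆ : A2 × A1).1.1 = x.1.1 * y.1.2 - x.1.2 * y.1.1 := rfl
    have h2 : (⁅x, y⁆ : A2 × A1).1.2 = 0 := rfl
    have h3 : A1.coord (⁅x, y⁆ : A2 × A1).2 = 0 := rfl
    change affineField U (C (⁅x, y⁆ : A2 × A1).1.2 * X + C (⁅x, y⁆ : A2 × A1).1.1)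
      (C (A1.coord (⁅x, y⁆ : A2 × A1).2)) 0 =
      ⁅affineField U (C x.1.2 * X + C x.1.1) (C (A1.coord x.2)) 0,
        affineField U (C y.1.2 * X + C y.1.1) (C (A1.coord y.2)) 0⁆
    rw [lie_affineField, h1, h2, h3]
    simp
    ring_nf

theorem scalingField_apply (x : A2 × A1) : scalingField U x =
    affineField U (C x.1.2 * X + C x.1.1) (C (A1.coord x.2)) 0 := rfl

theorem linPoly_eq_zero {a b : ℝ} (h : (C b * X + C a : ℝ[X]) = 0) : a = 0 ∧ b = 0 := by
  have h0 := congrArg (fun P : ℝ[X] => P.coeff 0) h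
  have h1 := congrArg (fun P : ℝ[X] => P.coeff 1) h
  simp [coeff_C] at h0 h1
  exact ⟨h0, h1⟩

theorem scalingField_injective (hU : (U : Set (ℝ × ℝ)).Nonempty) :
    Function.Injective (scalingField U) := by
  rw [injective_iff_map_eq_zero]
  intro x hx
  have h : ((C x.1.2 * X + C x.1.1, C (A1.coord x.2), 0) : ℝ[X] × ℝ[X] × ℝ[X]) = 0 :=
    affineFieldHom_injective hU (hx.trans (map_zero _).symm)
  simp only [Prod.mk_eq_zero, C_eq_zero] at h
  obtain ⟨h1, h2, -⟩ := h
  obtain ⟨h3, h4⟩ := linPoly_eq_zero h1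
  exact Prod.ext (A2.ext h3 h4) (A1.coord_injective (h2.trans (map_zero _).symm))

theorem mem_range_scalingField_iff (X : VField U) : X ∈ (scalingField U).range ↔
    ∃ (P : ℝ[X]) (c : ℝ), P.degree < (2 : ℕ) ∧ X = affineField U P (C c) 0 := by
  rw [LieHom.mem_range]
  constructor
  · rintro ⟨x, rfl⟩
    exact ⟨_, _, by exact_mod_cast degree_linear_lt, scalingField_apply x⟩
  · rintro ⟨P, c, hP, rfl⟩
    obtain ⟨a, b, rfl⟩ := exists_linPoly hP
    exact ⟨(((a, b) : ℝ × ℝ), A1.of c), rfl⟩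

/-- Coordinate vectors as polynomials of bounded degree. -/
def abelianPoly (m : ℕ) : AbelianLie m ≃ₗ[ℝ] degreeLT ℝ m := (degreeLTEquiv ℝ m).symm

theorem abelianPoly_coe {m : ℕ} (v : AbelianLie m) :
    (abelianPoly m v : ℝ[X]) = ∑ i : Fin m, monomial (i : ℕ) (v i) := rfl

theorem abelianPoly_unit {m : ℕ} (k : Fin m) :
    (abelianPoly m (AbelianLie.unit k) : ℝ[X]) = X ^ (k : ℕ) := by
  rw [abelianPoly_coe, Finset.sum_eq_single k]
  · have : AbelianLie.unit k k = 1 := Pi.single_eq_same _ _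
    rw [this, X_pow_eq_monomial]
  · intro i _ hi
    have : AbelianLie.unit k i = 0 := Pi.single_eq_of_ne hi _
    rw [this, map_zero]
  · simp

/-- The action of a field `P ∂_x + Q y ∂_y` on the coefficients of `R ∂_y`. -/
def polyAction (P Q : ℝ[X]) : ℝ[X] →ₗ[ℝ] ℝ[X] :=
  LinearMap.mulLeft ℝ P ∘ₗ derivative - LinearMap.mulLeft ℝ Q

theorem polyAction_apply (P Q R : ℝ[X]) : polyAction P Q R = P * derivative R - Q * R := rfl

/-- The weight `n/2` is the one for which the quadratic field preserves degree at most `n`: it sends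
`x^k` to a multiple of `(k - n) x^(k+1)`, which vanishes at the top degree. -/
theorem polyAction_mem_degreeLT (n : ℕ) (x : A1 × Sl2) {R : ℝ[X]} (hR : R ∈ degreeLT ℝ (n + 1)) :
    polyAction (sl2Poly x.2) (weightPoly ((n : ℝ) / 2) x) R ∈ degreeLT ℝ (n + 1) := by
  classical
  suffices h : degreeLT ℝ (n + 1) ≤ (degreeLT ℝ (n + 1)).comap
      (polyAction (sl2Poly x.2) (weightPoly ((n : ℝ) / 2) x)) from h hR
  conv_lhs => rw [degreeLT_eq_span_X_pow]
  rw [Submodule.span_le]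
  intro S hS
  simp only [Finset.coe_image, Finset.coe_range, Set.mem_image, Set.mem_Iio] at hS
  obtain ⟨k, hk, rfl⟩ := hS
  rw [SetLike.mem_coe, Submodule.mem_comap, polyAction_apply, weightPoly_apply, sl2Poly_apply,
    derivative_quadPoly]
  set a := x.2.1 0 1
  set b := -2 * x.2.1 0 0
  set c := -x.2.1 1 0
  have hmem : ∀ (r : ℝ) (j : ℕ), (r = 0 ∨ j < n + 1) → C r * X ^ j ∈ degreeLT ℝ (n + 1) := by
    rintro r j (rfl | hj)
    · simp
    · exact mem_degreeLT.2 ((degree_C_mul_X_pow_le _ _).trans_lt (by exact_mod_cast hj))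
  have hexp : quadPoly a b c * derivative (X ^ k) -
      (C ((n : ℝ) / 2) * (C (2 * c) * X + C b) + C (A1.coord x.1)) * X ^ k =
      C (a * k) * X ^ (k - 1) + C (b * k - n / 2 * b - A1.coord x.1) * X ^ k +
      C (c * (k - n)) * X ^ (k + 1) := by
    have hn : (C ((n : ℝ) / 2) * C (2 * c) : ℝ[X]) = C (n * c) := by
      rw [← C_mul]; congr 1; ring
    rw [derivative_X_pow, quadPoly]
    -- For `k = 0` the exponent `k - 1` is truncated to `0`, harmlessly, since its coefficient `a *
    -- k` vanishes.
    rcases k with _ | k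
    · simp only [Nat.cast_zero, C_0, pow_zero, C_sub, C_mul, mul_zero, zero_mul] at hn ⊢
      linear_combination -X * hn
    · simp only [Nat.add_sub_cancel, C_sub, C_mul] at hn ⊢
      linear_combination (-X ^ (k + 1) * X) * hn
  rw [hexp]
  refine add_mem (add_mem (hmem _ _ (Or.inr (by omega))) (hmem _ _ (Or.inr hk))) (hmem _ _ ?_)
  rcases (Nat.lt_succ_iff_lt_or_eq.1 hk) with h | h
  · exact Or.inr (by omega)
  · exact Or.inl (by rw [h]; ring)

/-- The endomorphism of `(n + 1) A₁` given by an element of `A₁ ⊕ sl(2, ℝ)`. -/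
def abelianEnd (n : ℕ) (x : A1 × Sl2) : AbelianLie (n + 1) →ₗ[ℝ] AbelianLie (n + 1) :=
  (abelianPoly (n + 1)).symm.toLinearMap ∘ₗ
    (polyAction (sl2Poly x.2) (weightPoly ((n : ℝ) / 2) x)).restrict
      (fun _ hR => polyAction_mem_degreeLT n x hR) ∘ₗ (abelianPoly (n + 1)).toLinearMap

theorem abelianPoly_abelianEnd (n : ℕ) (x : A1 × Sl2) (v : AbelianLie (n + 1)) :
    (abelianPoly (n + 1) (abelianEnd n x v) : ℝ[X]) =
      polyAction (sl2Poly x.2) (weightPoly ((n : ℝ) / 2) x) (abelianPoly (n + 1) v) := by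
  simp [abelianEnd]

theorem abelianPoly_coe_injective {m : ℕ} {v w : AbelianLie m}
    (h : (abelianPoly m v : ℝ[X]) = abelianPoly m w) : v = w :=
  (abelianPoly m).injective (Subtype.ext h)

theorem eq_zero_of_abelianPoly_eq_zero {m : ℕ} {v : AbelianLie m}
    (h : (abelianPoly m v : ℝ[X]) = 0) : v = 0 :=
  abelianPoly_coe_injective (by rw [h, map_zero]; rfl)

/-- The action of `A₁ ⊕ sl(2, ℝ)` on `(n + 1) A₁` by derivations. -/
def abelianAction (n : ℕ) :
    (A1 × Sl2) →ₗ⁅ℝ⁆ LieDerivation ℝ (AbelianLie (n + 1)) (AbelianLie (n + 1)) where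
  toFun x :=
    { toLinearMap := abelianEnd n x
      leibniz' := fun _ _ => (map_zero (abelianEnd n x)).trans (sub_zero 0).symm }
  map_add' x y := LieDerivation.ext fun v => by
    change abelianEnd n (x + y) v = abelianEnd n x v + abelianEnd n y v
    refine abelianPoly_coe_injective ?_
    rw [map_add (abelianPoly (n + 1)), Submodule.coe_add]
    simp only [abelianPoly_abelianEnd, polyAction_apply, Prod.snd_add, map_add]
    ring
  map_smul' c x := LieDerivation.ext fun v => by
    change abelianEnd n (c • x) v = c • abelianEnd n x v
    refine abelianPoly_coe_injective ?_
    rw [map_smul (abelianPoly (n + 1)), Submodule.coe_smul]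
    simp only [abelianPoly_abelianEnd, polyAction_apply, Prod.smul_snd, map_smul,
      smul_mul_assoc, smul_sub]
  map_lie' := by
    intro x y
    refine LieDerivation.ext fun v => ?_
    rw [LieDerivation.commutator_apply]
    change abelianEnd n ⁅x, y⁆ v =
      abelianEnd n x (abelianEnd n y v) - abelianEnd n y (abelianEnd n x v)
    refine abelianPoly_coe_injective ?_
    rw [map_sub (abelianPoly (n + 1)), Submodule.coe_sub]
    have h2 : (⁅x, y⁆ : A1 × Sl2).2 = ⁅x.2, y.2⁆ := rfl
    simp only [abelianPoly_abelianEnd, polyAction_apply, h2, sl2Poly_lie, weightPoly_lie,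
      derivative_sub, derivative_mul]
    ring

theorem abelianPoly_abelianAction (n : ℕ) (x : A1 × Sl2) (v : AbelianLie (n + 1)) :
    (abelianPoly (n + 1) (abelianAction n x v) : ℝ[X]) =
      sl2Poly x.2 * derivative (abelianPoly (n + 1) v : ℝ[X]) -
        weightPoly ((n : ℝ) / 2) x * abelianPoly (n + 1) v :=
  abelianPoly_abelianEnd n x v

/-- The realisation of `(n + 1) A₁ ⊕ₛ (A₁ ⊕ sl(2, ℝ))` by vector fields. -/
def semidirectField (U : Opens (ℝ × ℝ)) (n : ℕ) :
    LieAlgebra.SemiDirectSum (AbelianLie (n + 1)) (A1 × Sl2) (abelianAction n) →ₗ⁅ℝ⁆ VField U where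
  toFun z := affineField U (sl2Poly z.right.2) (weightPoly ((n : ℝ) / 2) z.right)
    (abelianPoly (n + 1) z.left)
  map_add' z w := by
    rw [← affineField_add, LieAlgebra.SemiDirectSum.add_eq_mk]
    simp only [map_add, Prod.snd_add, Submodule.coe_add]
  map_smul' c z := by
    rw [RingHom.id_apply, ← affineField_smul, LieAlgebra.SemiDirectSum.smul_eq_mk]
    simp only [map_smul, Prod.smul_snd, Submodule.coe_smul]
  map_lie' := by
    intro z w
    have h0 : ⁅z.left, w.left⁆ = 0 := rfl
    have h2 : (⁅z.right, w.right⁆ : A1 × Sl2).2 = ⁅z.right.2, w.right.2⁆ := rfl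
    rw [lie_affineField, LieAlgebra.SemiDirectSum.lie_eq_mk]
    simp only [h0, zero_add, h2, sl2Poly_lie, weightPoly_lie]
    congr 1
    rw [map_sub (abelianPoly (n + 1)), Submodule.coe_sub, abelianPoly_abelianAction,
      abelianPoly_abelianAction]
    ring

theorem semidirectField_mk (n : ℕ) (v : AbelianLie (n + 1)) (x : A1 × Sl2) :
    semidirectField U n ⟨v, x⟩ = affineField U (sl2Poly x.2) (weightPoly ((n : ℝ) / 2) x)
      (abelianPoly (n + 1) v) := rfl

theorem semidirectField_injective (hU : (U : Set (ℝ × ℝ)).Nonempty) (n : ℕ) :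
    Function.Injective (semidirectField U n) := by
  rw [injective_iff_map_eq_zero]
  rintro ⟨v, x⟩ hx
  have h : ((sl2Poly x.2, weightPoly ((n : ℝ) / 2) x, (abelianPoly (n + 1) v : ℝ[X])) :
      ℝ[X] × ℝ[X] × ℝ[X]) = 0 :=
    affineFieldHom_injective hU (hx.trans (map_zero _).symm)
  simp only [Prod.mk_eq_zero, weightPoly_apply] at h
  obtain ⟨h1, h2, h4⟩ := h
  rw [h1] at h2
  have h3 : A1.coord x.1 = 0 := by simpa using h2
  have hv : v = 0 := eq_zero_of_abelianPoly_eq_zero h4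
  have hx' : x = 0 := Prod.ext (A1.coord_injective (h3.trans (map_zero _).symm))
    (sl2Poly_injective (h1.trans (map_zero _).symm))
  rw [hv, hx']
  rfl

theorem mem_range_semidirectField_iff (n : ℕ) (X : VField U) : X ∈ (semidirectField U n).range ↔
    ∃ (P R : ℝ[X]) (c : ℝ), P.degree < (3 : ℕ) ∧ R.degree < (n + 1 : ℕ) ∧
      X = affineField U P (C ((n : ℝ) / 2) * derivative P + C c) R := by
  rw [LieHom.mem_range]
  constructor
  · rintro ⟨⟨v, x⟩, rfl⟩
    exact ⟨sl2Poly x.2, _, A1.coord x.1, quadPoly_degree_lt _ _ _,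
      mem_degreeLT.1 (abelianPoly (n + 1) v).2, rfl⟩
  · rintro ⟨P, R, c, hP, hR, rfl⟩
    obtain ⟨a, b, d, rfl⟩ := exists_quadPoly hP
    refine ⟨⟨(abelianPoly (n + 1)).symm ⟨R, mem_degreeLT.2 hR⟩,
      (A1.of c, Sl2.of (-b / 2) a (-d))⟩, ?_⟩
    rw [semidirectField_mk, weightPoly_apply, sl2Poly_of, A1.coord_of,
      LinearEquiv.apply_symm_apply]

end Realisation

/-! ### The listed fields -/

section Lists

variable {U : Opens (ℝ × ℝ)}

theorem dx_apply (i j : ℕ) {p : ℝ × ℝ} (hp : p ∈ U) :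
    (dx U i j).toFun p = (p.1 ^ i * p.2 ^ j, 0) := VField.restrict_apply hp

theorem dy_apply (i j : ℕ) {p : ℝ × ℝ} (hp : p ∈ U) :
    (dy U i j).toFun p = (0, p.1 ^ i * p.2 ^ j) := VField.restrict_apply hp

theorem dy_zero_eq (k : ℕ) : dy U k 0 = affineField U 0 0 (X ^ k) := VField.ext fun p hp => by
  rw [dy_apply _ _ hp, affineField_apply _ _ _ hp]; simp

theorem dy_one_eq (k : ℕ) : dy U k 1 = affineField U 0 (X ^ k) 0 := VField.ext fun p hp => by
  rw [dy_apply _ _ hp, affineField_apply _ _ _ hp]; simp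

theorem dx_zero_eq (k : ℕ) : dx U k 0 = affineField U (X ^ k) 0 0 := VField.ext fun p hp => by
  rw [dx_apply _ _ hp, affineField_apply _ _ _ hp]; simp

/-- The three quadratic fields are `P ∂_x + m P' y ∂_y` for `P = 1, x, x²`; the factor `2m` is the
derivative of `x²`. Writing a general combination as one affine field later yields both independence
and the span. -/
theorem quad_combination (m a b c : ℝ) : a • dx U 0 0 + b • (dx U 1 0 + m • dy U 0 1) +
    c • (dx U 2 0 + (2 * m) • dy U 1 1) =
      affineField U (quadPoly a b c) (C m * derivative (quadPoly a b c)) 0 := by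
  simp only [dx_zero_eq, dy_one_eq, ← affineField_smul, ← affineField_add, derivative_quadPoly]
  simp only [smul_eq_C_mul, quadPoly, C_mul]
  congr 1 <;> ring

theorem sum_symSpecial (n : ℕ) (g : Fin 4 → ℝ) : ∑ i, g i • symSpecial U n i =
    affineField U (quadPoly (g 0) (g 1) (g 2))
      (C (((n : ℝ) - 1) / 2) * derivative (quadPoly (g 0) (g 1) (g 2)) + C (g 3)) 0 := by
  have h := quad_combination (U := U) (((n : ℝ) - 1) / 2) (g 0) (g 1) (g 2)
  rw [mul_div_cancel₀ _ (two_ne_zero' ℝ)] at h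
  simp only [Fin.sum_univ_four, symSpecial, Matrix.cons_val]
  rw [h, dy_one_eq, ← affineField_smul, ← affineField_add]
  simp [smul_eq_C_mul]

theorem sum_symGeneric (g : Fin 3 → ℝ) : ∑ i, g i • symGeneric U i =
    affineField U (C (g 1) * X + C (g 0)) (C (g 2)) 0 := by
  simp only [Fin.sum_univ_three, symGeneric, Matrix.cons_val]
  rw [dx_zero_eq, dx_zero_eq, dy_one_eq]
  simp only [← affineField_smul, ← affineField_add]
  simp [smul_eq_C_mul, add_comm]

theorem sum_symZero_quad (n : ℕ) (g : Fin 3 → ℝ) :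
    ∑ i, g i • symZero U n (Sum.inr (Sum.inr i)) =
      affineField U (quadPoly (g 0) (g 1) (g 2))
        (C ((n : ℝ) / 2) * derivative (quadPoly (g 0) (g 1) (g 2))) 0 := by
  have h := quad_combination (U := U) ((n : ℝ) / 2) (g 0) (g 1) (g 2)
  rw [mul_div_cancel₀ _ (two_ne_zero' ℝ)] at h
  rw [← h]
  simp [Fin.sum_univ_three, symZero]

theorem sum_symZero (n : ℕ) (g : Fin (n + 1) ⊕ Fin 1 ⊕ Fin 3 → ℝ) : ∑ i, g i • symZero U n i =
    affineField U
      (quadPoly (g (.inr (.inr 0))) (g (.inr (.inr 1))) (g (.inr (.inr 2))))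
      (C ((n : ℝ) / 2) *
        derivative (quadPoly (g (.inr (.inr 0))) (g (.inr (.inr 1))) (g (.inr (.inr 2)))) +
        C (g (.inr (.inl 0))))
      (∑ k : Fin (n + 1), monomial (k : ℕ) (g (.inl k))) := by
  have h1 : ∑ k : Fin (n + 1), g (.inl k) • symZero U n (.inl k) =
      affineField U 0 0 (∑ k : Fin (n + 1), monomial (k : ℕ) (g (.inl k))) := by
    have : ∀ R : ℝ[X], affineField U 0 0 R =
        (affineFieldHom U ∘ₗ (LinearMap.inr ℝ ℝ[X] (ℝ[X] × ℝ[X])) ∘ₗ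
          LinearMap.inr ℝ ℝ[X] ℝ[X]) R := fun R => rfl
    rw [this, map_sum]
    refine Finset.sum_congr rfl fun k _ => ?_
    rw [← this, symZero, Sum.elim_inl, dy_zero_eq, ← affineField_smul, smul_zero,
      smul_X_eq_monomial]
  rw [Fintype.sum_sum_type, Fintype.sum_sum_type, h1,
    sum_symZero_quad n (fun i => g (.inr (.inr i)))]
  simp only [Finset.univ_unique, Fin.default_eq_zero, Finset.sum_singleton]
  rw [show symZero U n (.inr (.inl 0)) = dy U 0 1 from rfl, dy_one_eq, ← affineField_smul,
    ← affineField_add, ← affineField_add]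
  simp [smul_eq_C_mul, add_comm]

end Lists

/-! ### Independence, spans and dimensions -/

section Main

variable {U : Opens (ℝ × ℝ)}

theorem affineField_eq_zero (hU : (U : Set (ℝ × ℝ)).Nonempty) {P Q R : ℝ[X]}
    (h : affineField U P Q R = 0) : P = 0 ∧ Q = 0 ∧ R = 0 := by
  have : ((P, Q, R) : ℝ[X] × ℝ[X] × ℝ[X]) = 0 :=
    affineFieldHom_injective hU (h.trans (map_zero _).symm)
  simpa using this

theorem linearIndependent_symZero (hU : (U : Set (ℝ × ℝ)).Nonempty) (n : ℕ) :
    LinearIndependent ℝ (symZero U n) := by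
  rw [Fintype.linearIndependent_iff]
  intro g hg
  rw [sum_symZero] at hg
  obtain ⟨h1, h2, h3⟩ := affineField_eq_zero hU hg
  rw [h1] at h2
  rw [quadPoly_eq_zero_iff] at h1
  have h4 : g (.inr (.inl 0)) = 0 := by simpa using h2
  have h5 : (fun k => g (.inl k) : AbelianLie (n + 1)) = 0 :=
    eq_zero_of_abelianPoly_eq_zero ((abelianPoly_coe _).trans h3)
  rintro (k | k | k)
  · exact congrFun h5 k
  · rw [Subsingleton.elim k 0]; exact h4
  · fin_cases k
    exacts [h1.1, h1.2.1, h1.2.2]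

theorem linearIndependent_symSpecial (hU : (U : Set (ℝ × ℝ)).Nonempty) (n : ℕ) :
    LinearIndependent ℝ (symSpecial U n) := by
  rw [Fintype.linearIndependent_iff]
  intro g hg
  rw [sum_symSpecial] at hg
  obtain ⟨h1, h2, -⟩ := affineField_eq_zero hU hg
  rw [h1] at h2
  rw [quadPoly_eq_zero_iff] at h1
  have h4 : g 3 = 0 := by simpa using h2
  intro i
  fin_cases i
  exacts [h1.1, h1.2.1, h1.2.2, h4]

theorem linearIndependent_symGeneric (hU : (U : Set (ℝ × ℝ)).Nonempty) :
    LinearIndependent ℝ (symGeneric U) := by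
  rw [Fintype.linearIndependent_iff]
  intro g hg
  rw [sum_symGeneric] at hg
  obtain ⟨h1, h2, -⟩ := affineField_eq_zero hU hg
  obtain ⟨h3, h4⟩ := linPoly_eq_zero h1
  have h5 : g 2 = 0 := by simpa using h2
  intro i
  fin_cases i
  exacts [h3, h4, h5]

theorem range_semidirectField (n : ℕ) : (semidirectField U n).range.toSubmodule =
    Submodule.span ℝ (Set.range (symZero U n)) := by
  ext X
  rw [LieSubalgebra.mem_toSubmodule, mem_range_semidirectField_iff,
    Submodule.mem_span_range_iff_exists_fun]
  simp only [sum_symZero]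
  constructor
  · rintro ⟨P, R, c, hP, hR, rfl⟩
    obtain ⟨a, b, d, rfl⟩ := exists_quadPoly hP
    refine ⟨Sum.elim (fun k => R.coeff k) (Sum.elim ![c] ![a, b, d]), ?_⟩
    congr 1
    exact (abelianPoly_coe _).symm.trans (congrArg Subtype.val
      ((abelianPoly (n + 1)).apply_symm_apply ⟨R, mem_degreeLT.2 hR⟩))
  · rintro ⟨g, rfl⟩
    exact ⟨_, _, _, quadPoly_degree_lt _ _ _,
      mem_degreeLT.1 (abelianPoly (n + 1) fun k => g (.inl k)).2, rfl⟩

theorem range_sl2Field (n : ℕ) : (sl2Field U (((n : ℝ) - 1) / 2)).range.toSubmodule =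
    Submodule.span ℝ (Set.range (symSpecial U n)) := by
  ext X
  rw [LieSubalgebra.mem_toSubmodule, mem_range_sl2Field_iff,
    Submodule.mem_span_range_iff_exists_fun]
  simp only [sum_symSpecial]
  constructor
  · rintro ⟨P, c, hP, rfl⟩
    obtain ⟨a, b, d, rfl⟩ := exists_quadPoly hP
    exact ⟨![a, b, d, c], rfl⟩
  · rintro ⟨g, rfl⟩
    exact ⟨_, _, quadPoly_degree_lt _ _ _, rfl⟩

theorem range_scalingField : (scalingField U).range.toSubmodule =
    Submodule.span ℝ (Set.range (symGeneric U)) := by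
  ext X
  rw [LieSubalgebra.mem_toSubmodule, mem_range_scalingField_iff,
    Submodule.mem_span_range_iff_exists_fun]
  simp only [sum_symGeneric]
  constructor
  · rintro ⟨P, c, hP, rfl⟩
    obtain ⟨a, b, rfl⟩ := exists_linPoly hP
    exact ⟨![a, b, c], rfl⟩
  · rintro ⟨g, rfl⟩
    exact ⟨_, _, by exact_mod_cast degree_linear_lt, rfl⟩

theorem finrank_of_toSubmodule_eq_span {ι : Type*} [Fintype ι] {v : ι → VField U}
    (hv : LinearIndependent ℝ v) {L : LieSubalgebra ℝ (VField U)}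
    (hL : L.toSubmodule = Submodule.span ℝ (Set.range v)) :
    Module.finrank ℝ L = Fintype.card ι := by
  rw [← finrank_span_eq_card hv, ← hL]
  rfl

end Main

end LiePointSymmetry

end

/-! ### The classification theorem -/

theorem theorem1 (n : ℕ) (hn : 2 ≤ n) (α : ℝ) (U : Opens (ℝ × ℝ))
    (hU : IsConnected (U : Set (ℝ × ℝ))) (hy : ∀ p ∈ U, p.2 ≠ 0) :
    (α = 0 →
      ∃ L : LieSubalgebra ℝ (VField U),
        (∀ X : VField U, X ∈ L ↔ IsLiePointSymmetry (ode n α) X) ∧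
        LinearIndependent ℝ (symZero U n) ∧
        L.toSubmodule = Submodule.span ℝ (Set.range (symZero U n)) ∧
        Module.finrank ℝ L = n + 5 ∧
        ∃ (ψ : (A1 × Sl2) →ₗ⁅ℝ⁆ LieDerivation ℝ (AbelianLie (n + 1)) (AbelianLie (n + 1)))
          (e : L ≃ₗ⁅ℝ⁆ LieAlgebra.SemiDirectSum (AbelianLie (n + 1)) (A1 × Sl2) ψ),
          (∀ k : Fin (n + 1),
            (e.symm (LieAlgebra.SemiDirectSum.inl ψ (AbelianLie.unit k)) : VField U)
              = symZero U n (Sum.inl k)) ∧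
          (e.symm (LieAlgebra.SemiDirectSum.inr ψ (AbelianLie.unit 0, 0)) : VField U)
            = symZero U n (Sum.inr (Sum.inl 0)) ∧
          (∀ s : Sl2, (e.symm (LieAlgebra.SemiDirectSum.inr ψ (0, s)) : VField U) ∈
            Submodule.span ℝ (Set.range fun i : Fin 3 => symZero U n (Sum.inr (Sum.inr i))))) ∧
    (3 ≤ n → α = ((n : ℝ) + 1) / ((n : ℝ) - 1) →
      ∃ L : LieSubalgebra ℝ (VField U),
        (∀ X : VField U, X ∈ L ↔ IsLiePointSymmetry (ode n α) X) ∧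
        LinearIndependent ℝ (symSpecial U n) ∧
        L.toSubmodule = Submodule.span ℝ (Set.range (symSpecial U n)) ∧
        Module.finrank ℝ L = 4 ∧
        Nonempty (L ≃ₗ⁅ℝ⁆ A1 × Sl2)) ∧
    (α ≠ 0 → α ≠ ((n : ℝ) + 1) / ((n : ℝ) - 1) →
      ∃ L : LieSubalgebra ℝ (VField U),
        (∀ X : VField U, X ∈ L ↔ IsLiePointSymmetry (ode n α) X) ∧
        LinearIndependent ℝ (symGeneric U) ∧
        L.toSubmodule = Submodule.span ℝ (Set.range (symGeneric U)) ∧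
        Module.finrank ℝ L = 3 ∧
        Nonempty (L ≃ₗ⁅ℝ⁆ A2 × A1)) := by
  obtain ⟨N, rfl⟩ := Nat.exists_eq_add_of_le' hn
  have hne := hU.nonempty
  have hpre := hU.isPreconnected
  refine ⟨?_, ?_, ?_⟩
  · rintro rfl
    have hinj := semidirectField_injective hne (N + 2)
    -- Taking `L` to be the range of the realisation gives closure under brackets and the
    -- isomorphism for free; the inverse `e.symm` is the realisation itself, so the images of the
    -- basis elements can be computed.
    refine ⟨(semidirectField U (N + 2)).range, fun X => ?_, linearIndependent_symZero hne _,
      range_semidirectField _, ?_, abelianAction (N + 2),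
      (LieEquiv.ofInjective (semidirectField U (N + 2)) hinj).symm, fun k => ?_, ?_, fun s => ?_⟩
    · rw [mem_range_semidirectField_iff, isLiePointSymmetry_ode_zero_iff hpre hy]
      push_cast
      rfl
    · rw [finrank_of_toSubmodule_eq_span (linearIndependent_symZero hne _)
        (range_semidirectField _)]
      simp
    · rw [LieEquiv.symm_symm, LieEquiv.ofInjective_apply, LieAlgebra.SemiDirectSum.inl_eq_mk,
        semidirectField_mk, abelianPoly_unit, symZero, Sum.elim_inl, dy_zero_eq]
      simp
    · rw [LieEquiv.symm_symm, LieEquiv.ofInjective_apply, LieAlgebra.SemiDirectSum.inr_eq_mk,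
        semidirectField_mk, weightPoly_apply]
      change _ = dy U 0 1
      rw [dy_one_eq, A1.coord_unit]
      simp
    · rw [LieEquiv.symm_symm, LieEquiv.ofInjective_apply, LieAlgebra.SemiDirectSum.inr_eq_mk,
        semidirectField_mk, weightPoly_apply, Submodule.mem_span_range_iff_exists_fun]
      -- These are the coefficients of `1`, `x`, `x²` in `sl2Poly s`.
      refine ⟨![s.1 0 1, -2 * s.1 0 0, -s.1 1 0], ?_⟩
      rw [sum_symZero_quad]
      simp [sl2Poly_apply]
  · intro h3 hα
    have hN : 1 ≤ N := by omega
    have hα' : α * (N + 1) = N + 3 := by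
      have h : (N : ℝ) + 1 ≠ 0 := by positivity
      rw [hα]
      push_cast
      rw [show (N : ℝ) + 2 - 1 = N + 1 by ring, div_mul_cancel₀ _ h]
      ring
    refine ⟨(sl2Field U ((((N + 2 : ℕ) : ℝ) - 1) / 2)).range, fun X => ?_,
      linearIndependent_symSpecial hne _, range_sl2Field _, ?_,
      ⟨(LieEquiv.ofInjective _ (sl2Field_injective hne _)).symm⟩⟩
    · rw [mem_range_sl2Field_iff, isLiePointSymmetry_ode_special_iff hpre hy hN hα',
        show (((N + 2 : ℕ) : ℝ) - 1) / 2 = ((N : ℝ) + 1) / 2 by push_cast; ring]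
    · rw [finrank_of_toSubmodule_eq_span (linearIndependent_symSpecial hne _) (range_sl2Field _)]
      simp
  · intro h0 hα
    have hα' : α * (N + 1) ≠ N + 3 := by
      intro h
      apply hα
      have h1 : (N : ℝ) + 1 ≠ 0 := by positivity
      push_cast
      rw [show (N : ℝ) + 2 - 1 = N + 1 by ring, eq_div_iff h1, h]
      ring
    refine ⟨(scalingField U).range, fun X => ?_, linearIndependent_symGeneric hne,
      range_scalingField, ?_, ⟨(LieEquiv.ofInjective _ (scalingField_injective hne)).symm⟩⟩
    · rw [mem_range_scalingField_iff, isLiePointSymmetry_ode_generic_iff hpre hy h0 hα']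
    · rw [finrank_of_toSubmodule_eq_span (linearIndependent_symGeneric hne) range_scalingField]
      simp
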